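/- **Setup.** Fix $\alpha\in(0,1)$. For each $n\ge 1$ let $p_n\ge 0$ be an integer and let the data $(X_i,Y_i,Z_i)_{i=1}^n$ be i.i.d. from a law $\mathcal L_n$ on $\mathbb R\times\mathbb R\times\mathbb R^{p_n}$ with $\mathbb E|X|,\mathbb E|Y|<\infty$; write $\mu_{n,x}(z)=\mathbb E_{\mathcal L_n}[X\mid Z=z]$, $\mu_{n,y}(z)=\mathbb E_{\mathcal L_n}[Y\mid Z=z]$. Let $\mathscr L^0_n$ be the set of laws with $X\perp\!\!\!\perp Y\mid Z$. From $(X_i,Z_i)_{i\le n}$ one learns a conditional law $\widehat{\mathcal L}_n(x\mid z)$, with mean $\widehat\mu_{n,x}(z)$ and variance $\mathrm{Var}_{\widehat{\mathcal L}_n}[X\mid Z=z]$; from $(Y_i,Z_i)_{i\le n}$ one learns a function $\widehat\mu_{n,y}(z)$ (both learning rules are arbitrary measurable rules). Given the data, let $\widetilde X_1,\dots,\widetilde X_n$ be independent with $\widetilde X_i\sim\widehat{\mathcal L}_n(\cdot\mid Z_i)$. For $x'\in\mathbb R^n$ put $W_i(x')=(x'_i-\widehat\mu_{n,x}(Z_i))(Y_i-\widehat\mu_{n,y}(Z_i))$,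 with $\widehat\mu_{n,x},\widehat\mu_{n,y}$ fitted on the original data, and $$T_n(x')=\frac{n^{-1/2}\sum_{i=1}^n W_i(x')}{\Big(\frac1n\sum_{i=1}^n W_i(x')^2-\big(\frac1n\sum_{i=1}^n W_i(x')\big)^2\Big)^{1/2}}$$ (with $T_n(x')=0$ if the denominator vanishes). The normalized $\widehat{\mathrm{dCRT}}$ (in its infinite-resamples form) is the test $$\phi_n=\mathbf 1\{T_n(X)>C_n\},\qquad C_n=\inf\{t:\mathbb P[T_n(\widetilde X)\le t\mid X,Y,Z]\ge 1-\alpha\}.$$ **Conditions on a sequence $(\mathcal L_n)_{n\ge1}$** (given the learning rules; probabilities under $\mathcal L_n$; the constants may depend on the sequence). * (NDG1) For some $\epsilon>0$, $\mathbb P\big[\frac1n\sum_{i}\mathrm{Var}_{\widehat{\mathcal L}_n}[X_i\mid Z_i](Y_i-\widehat\mu_{n,y}(Z_i))^2\ge\epsilon\big]\to1$. * (NDG2) For all $n$ and $i\le n$, almost surely $0<\mathrm{Var}_{\widehat{\mathcal L}_n}[X_i\mid Z_i]<\infty$, $0<(Y_i-\widehat\mu_{n,y}(Z_i))^2<\infty$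 and $0<(Y_i-\mu_{n,y}(Z_i))^2<\infty$. * (Lyap-1) For some $\delta>0$, $n^{-(1+\delta/2)}\sum_i|Y_i-\widehat\mu_{n,y}(Z_i)|^{2+\delta}\,\mathbb E\big[|\widetilde X_i-\widehat\mu_{n,x}(Z_i)|^{2+\delta}\mid X,Y,Z\big]\to0$ in probability. * (SP1) $E_{n,x}E_{n,y}=o_{\mathbb P}(n^{-1/2})$, $E'_{n,x}=o_{\mathbb P}(1)$, $E'_{n,y}=o_{\mathbb P}(1)$, where $E_{n,x}^2=\frac1n\sum_i(\widehat\mu_{n,x}(Z_i)-\mu_{n,x}(Z_i))^2$, $E_{n,y}^2=\frac1n\sum_i(\widehat\mu_{n,y}(Z_i)-\mu_{n,y}(Z_i))^2$, $(E'_{n,x})^2=\frac1n\sum_i(\widehat\mu_{n,x}(Z_i)-\mu_{n,x}(Z_i))^2\,\mathrm{Var}_{\mathcal L_n}[Y_i\mid Z_i]$, and $(E'_{n,y})^2=\frac1n\sum_i(\widehat\mu_{n,y}(Z_i)-\mu_{n,y}(Z_i))^2\,\mathrm{Var}_{\mathcal L_n}[X_i\mid Z_i]$. * (SP2) For some $c_1,c_2,\delta>0$,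 $\inf_n\mathbb E_{\mathcal L_n}[(X-\mu_{n,x}(Z))^2(Y-\mu_{n,y}(Z))^2]>c_1$ and $\sup_n\mathbb E_{\mathcal L_n}[|(X-\mu_{n,x}(Z))(Y-\mu_{n,y}(Z))|^{2+\delta}]<c_2$. **Corollary.** For each $n\ge1$ let $\mathscr R_n$ be a nonempty set of laws with $\mathbb E|X|,\mathbb E|Y|<\infty$, such that every sequence $(\mathcal L_n)_{n\ge1}$ with $\mathcal L_n\in\mathscr R_n$ for all $n$ satisfies (NDG1), (NDG2), (Lyap-1), (SP1) and (SP2). Then $$\limsup_{n\to\infty}\ \sup_{\mathcal L_n\in\mathscr L^0_n\cap\mathscr R_n}\mathbb E_{\mathcal L_n}[\phi_n]\le\alpha$$ (a supremum over the empty set being $0$). In particular, $\mathrm{Var}_{\widehat{\mathcal L}_n}[X\mid Z]$ need not estimate $\mathrm{Var}_{\mathcal L_n}[X\mid Z]$ with any accuracy. -/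

import Mathlib

open MeasureTheory ProbabilityTheory Filter Topology
open scoped ENNReal

noncomputable section

namespace NDCRT

/-- One observation `(X, Y, Z)` with scalar `X` and `Y` and `p`-dimensional covariates `Z`. -/
abbrev Obs (p : ℕ) : Type := ℝ × ℝ × (Fin p → ℝ)

/-- The predictor `X` of an observation. -/
def obsX {p : ℕ} (o : Obs p) : ℝ := o.1

/-- The response `Y` of an observation. -/
def obsY {p : ℕ} (o : Obs p) : ℝ := o.2.1

/-- The covariates `Z` of an observation. -/
def obsZ {p : ℕ} (o : Obs p) : Fin p → ℝ := o.2.2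

theorem measurable_obsX {p : ℕ} : Measurable (obsX (p := p)) := measurable_fst

theorem measurable_obsY {p : ℕ} : Measurable (obsY (p := p)) :=
  measurable_fst.comp measurable_snd

theorem measurable_obsZ {p : ℕ} : Measurable (obsZ (p := p)) :=
  measurable_snd.comp measurable_snd

/-- A sample of `n` observations. -/
abbrev Data (p n : ℕ) : Type := Fin n → Obs p

/-- The vector `(X₁, …, Xₙ)` of the sample. -/
def Data.x {p n : ℕ} (d : Data p n) : Fin n → ℝ := fun i => obsX (d i)

/-- The vector `(Y₁, …, Yₙ)` of the sample. -/
def Data.y {p n : ℕ} (d : Data p n) : Fin n → ℝ := fun i => obsY (d i)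

/-- The covariates `(Z₁, …, Zₙ)` of the sample. -/
def Data.z {p n : ℕ} (d : Data p n) : Fin n → (Fin p → ℝ) := fun i => obsZ (d i)

/-- The law of a sample of `n` independent observations from `L`. -/
def sampleLaw {p : ℕ} (n : ℕ) (L : ProbabilityMeasure (Obs p)) : Measure (Data p n) :=
  Measure.pi fun _ => (L : Measure (Obs p))

/-- `z ↦ E_L[V | Z = z]`, the mean of the conditional law of `V` given `Z = z`. -/
def condMean {p : ℕ} (L : ProbabilityMeasure (Obs p)) (V : Obs p → ℝ) (z : Fin p → ℝ) : ℝ :=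
  ∫ v, v ∂(condDistrib V obsZ (L : Measure (Obs p)) z)

/-- `z ↦ Var_L[V | Z = z] ∈ [0, ∞]`, the variance of the conditional law of `V` given `Z = z`. -/
def condVar {p : ℕ} (L : ProbabilityMeasure (Obs p)) (V : Obs p → ℝ) (z : Fin p → ℝ) : ℝ≥0∞ :=
  evariance id (condDistrib V obsZ (L : Measure (Obs p)) z)

/-- The laws under which `X` and `Y` are conditionally independent given `Z`. -/
def nullLaws (p : ℕ) : Set (ProbabilityMeasure (Obs p)) :=
  {L | CondIndepFun (MeasurableSpace.comap obsZ inferInstance) measurable_obsZ.comap_le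
    obsX obsY (L : Measure (Obs p))}

/-- The two learning rules for samples of size `n`: a conditional law `z ↦ lawHat (·, z)` of `X`
given `Z = z`, learned from the `X` and `Z` parts of the sample, and an estimate `muHatY (·, z)` of
the conditional mean of `Y` given `Z = z`, learned from the `Y` and `Z` parts of the sample. -/
structure Learner (p n : ℕ) where
  lawHat : Kernel (((Fin n → ℝ) × (Fin n → (Fin p → ℝ))) × (Fin p → ℝ)) ℝ
  isMarkovKernel_lawHat : IsMarkovKernel lawHat
  muHatY : ((Fin n → ℝ) × (Fin n → (Fin p → ℝ))) × (Fin p → ℝ) → ℝ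
  measurable_muHatY : Measurable muHatY

namespace Learner

variable {p n : ℕ} (A : Learner p n) (d : Data p n)

/-- The learned conditional law of `Xᵢ` given `Zᵢ`. -/
def fittedLaw (i : Fin n) : Measure ℝ := A.lawHat ((d.x, d.z), d.z i)

instance (i : Fin n) : IsProbabilityMeasure (A.fittedLaw d i) :=
  A.isMarkovKernel_lawHat.isProbabilityMeasure _

/-- The fitted value for `Xᵢ`: the mean of the learned conditional law of `Xᵢ` given `Zᵢ`. -/
def fitX (i : Fin n) : ℝ := ∫ x, x ∂(A.fittedLaw d i)

/-- The fitted value for `Yᵢ`. -/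
def fitY (i : Fin n) : ℝ := A.muHatY ((d.y, d.z), d.z i)

/-- The variance, in `[0, ∞]`, of the learned conditional law of `Xᵢ` given `Zᵢ`. -/
def fittedVar (i : Fin n) : ℝ≥0∞ := evariance id (A.fittedLaw d i)

/-- The law of the resampled predictors given the sample: independent draws from the learned
conditional laws. -/
def resampleLaw : Measure (Fin n → ℝ) := Measure.pi fun i => A.fittedLaw d i

/-- Products of residuals, with the predictors replaced by `x'` and no refitting. -/
def residProd (x' : Fin n → ℝ) (i : Fin n) : ℝ := (x' i - A.fitX d i) * (d.y i - A.fitY d i)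

/-- The unnormalized statistic with the predictors replaced by `x'` and no refitting. The statistic
of the sample itself is the case `x' = d.x`. -/
def dcrtStat (x' : Fin n → ℝ) : ℝ := (√(n : ℝ))⁻¹ * ∑ i, A.residProd d x' i

end Learner

/-- The empirical variance of `w₁, …, wₙ` (with normalization `1 / n`). -/
def empVar {n : ℕ} (w : Fin n → ℝ) : ℝ :=
  (n : ℝ)⁻¹ * ∑ i, w i ^ 2 - ((n : ℝ)⁻¹ * ∑ i, w i) ^ 2

namespace Learner

variable {p n : ℕ} (A : Learner p n) (d : Data p n)

/-- The normalized statistic with the predictors replaced by `x'`, in the numerator and in the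
normalization, and no refitting. The statistic of the sample itself is the case `x' = d.x`.
It is `0` where the empirical variance vanishes. -/
def ndcrtStat (x' : Fin n → ℝ) : ℝ := A.dcrtStat d x' / √(empVar (A.residProd d x'))

/-- The critical value: the conditional `(1 - α)`-quantile, given the sample, of the normalized
statistic at the resampled predictors. -/
def ndcrtCrit (α : ℝ) : ℝ :=
  sInf {t : ℝ | 1 - α ≤ (A.resampleLaw d).real {x' | A.ndcrtStat d x' ≤ t}}

open Classical in
/-- The normalized test: the indicator that the statistic exceeds the critical value. -/
def ndcrtTest (α : ℝ) : ℝ≥0∞ := if A.ndcrtCrit d α < A.ndcrtStat d d.x then 1 else 0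

/-- The conditional variance, given the sample, of the unnormalized statistic at the resampled
predictors, `(1 / n) ∑ᵢ Varhat[Xᵢ | Zᵢ] (Yᵢ - fitYᵢ)²`. -/
def dcrtVar : ℝ≥0∞ :=
  (n : ℝ≥0∞)⁻¹ * ∑ i, A.fittedVar d i * ENNReal.ofReal ((d.y i - A.fitY d i) ^ 2)

/-- The Lyapunov ratio of exponent `2 + δ`. -/
def lyapunov (δ : ℝ) : ℝ≥0∞ :=
  ENNReal.ofReal ((n : ℝ) ^ (1 + δ / 2))⁻¹ * ∑ i,
    ENNReal.ofReal (|d.y i - A.fitY d i| ^ (2 + δ)) *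
      ∫⁻ x, ENNReal.ofReal (|x - A.fitX d i| ^ (2 + δ)) ∂(A.fittedLaw d i)

variable (L : ProbabilityMeasure (Obs p))

/-- Root mean squared in-sample error of the fit for `X`. -/
def errX : ℝ≥0∞ :=
  ((n : ℝ≥0∞)⁻¹ * ∑ i,
    ENNReal.ofReal ((A.fitX d i - condMean L obsX (d.z i)) ^ 2)) ^ (1 / 2 : ℝ)

/-- Root mean squared in-sample error of the fit for `Y`. -/
def errY : ℝ≥0∞ :=
  ((n : ℝ≥0∞)⁻¹ * ∑ i,
    ENNReal.ofReal ((A.fitY d i - condMean L obsY (d.z i)) ^ 2)) ^ (1 / 2 : ℝ)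

/-- The in-sample error of the fit for `X`, weighted by `Var[Y | Z]`. -/
def errX' : ℝ≥0∞ :=
  ((n : ℝ≥0∞)⁻¹ * ∑ i,
    ENNReal.ofReal ((A.fitX d i - condMean L obsX (d.z i)) ^ 2) *
      condVar L obsY (d.z i)) ^ (1 / 2 : ℝ)

/-- The in-sample error of the fit for `Y`, weighted by `Var[X | Z]`. -/
def errY' : ℝ≥0∞ :=
  ((n : ℝ≥0∞)⁻¹ * ∑ i,
    ENNReal.ofReal ((A.fitY d i - condMean L obsY (d.z i)) ^ 2) *
      condVar L obsX (d.z i)) ^ (1 / 2 : ℝ)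

end Learner

/-- Convergence to `0` in probability of `[0, ∞]`-valued variables `W n` on spaces varying
with `n`. -/
def TendstoZeroInProb {Ω : ℕ → Type} [∀ n, MeasurableSpace (Ω n)] (P : ∀ n, Measure (Ω n))
    (W : ∀ n, Ω n → ℝ≥0∞) : Prop :=
  ∀ ε : ℝ≥0∞, 0 < ε → Tendsto (fun n => P n {ω | ε ≤ W n ω}) atTop (𝓝 0)

section Conditions

variable {p : ℕ → ℕ} (A : ∀ n, Learner (p n) n) (L : ∀ n, ProbabilityMeasure (Obs (p n)))

/-- The resampling variance is bounded away from zero with probability tending to one. -/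
def NDG1 : Prop :=
  ∃ ε : ℝ, 0 < ε ∧ Tendsto
    (fun n => sampleLaw n (L n) {d | ENNReal.ofReal ε ≤ (A n).dcrtVar d}) atTop (𝓝 1)

/-- Almost surely, the learned conditional variances are positive and finite, and the residuals of
`Y` from its fitted and from its true conditional mean are nonzero (they are finite, being real). -/
def NDG2 : Prop :=
  ∀ n, 1 ≤ n → ∀ᵐ d ∂(sampleLaw n (L n)), ∀ i,
    (0 < (A n).fittedVar d i ∧ (A n).fittedVar d i < ∞) ∧
      0 < (Data.y d i - (A n).fitY d i) ^ 2 ∧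
      0 < (Data.y d i - condMean (L n) obsY (Data.z d i)) ^ 2

/-- The conditional Lyapunov condition. -/
def Lyap1 : Prop :=
  ∃ δ : ℝ, 0 < δ ∧
    TendstoZeroInProb (fun n => sampleLaw n (L n)) (fun n d => (A n).lyapunov d δ)

/-- Doubly robust estimation rates; the first clause says that the product of the two errors is
`o(n ^ (-1/2))` in probability. -/
def SP1 : Prop :=
  TendstoZeroInProb (fun n => sampleLaw n (L n))
      (fun n d => (n : ℝ≥0∞) ^ (1 / 2 : ℝ) * ((A n).errX d (L n) * (A n).errY d (L n))) ∧
    TendstoZeroInProb (fun n => sampleLaw n (L n)) (fun n d => (A n).errX' d (L n)) ∧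
    TendstoZeroInProb (fun n => sampleLaw n (L n)) (fun n d => (A n).errY' d (L n))

/-- Moment bounds on the product of the true residuals. -/
def SP2 : Prop :=
  ∃ c₁ c₂ δ : ℝ, 0 < c₁ ∧ 0 < c₂ ∧ 0 < δ ∧
    ENNReal.ofReal c₁ < (⨅ (n : ℕ) (_ : 1 ≤ n), ∫⁻ o, ENNReal.ofReal
      ((obsX o - condMean (L n) obsX (obsZ o)) ^ 2 *
        (obsY o - condMean (L n) obsY (obsZ o)) ^ 2) ∂(L n : Measure (Obs (p n)))) ∧
    (⨆ (n : ℕ) (_ : 1 ≤ n), ∫⁻ o, ENNReal.ofReal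
      (|(obsX o - condMean (L n) obsX (obsZ o)) *
        (obsY o - condMean (L n) obsY (obsZ o))| ^ (2 + δ)) ∂(L n : Measure (Obs (p n)))) <
      ENNReal.ofReal c₂

end Conditions

end NDCRT

end

open MeasureTheory ProbabilityTheory Filter Topology
open scoped ENNReal

noncomputable section

namespace NDCRT

/-! The observed and the resampled statistics are both divided by their own empirical standard
deviation, so both have a standard normal limit whatever their variances are. This is why the fitted
conditional variance need not be accurate. Only an upper bound on the rejection probability is
needed: fix `t` slightly below the normal `(1 - α)`-quantile, show that the critical value is at
least `t` with probability tending to one, and bound the probability that the observed statistic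
exceeds `t` by `α` plus a small error.

Given the data, the resampled products of residuals are independent and exactly centered. (NDG1) and
(Lyap-1) make their Lyapunov ratio small with high probability. A central limit theorem uniform over
all such arrays (`exists_studentized_clt`) then puts conditional mass less than `1 - α` on `(-∞, t]`
(`Learner.exists_resample_lt`).

For the observed statistic, let `ξ`, `ζ` be the true residuals of `X`, `Y`, and `a`, `b` the true
minus the fitted conditional means. Each product of residuals is `(ξ + a)(ζ + b) = ξζ + ξb + ζa +
ab`. Under the null the `ξζ` are i.i.d. and centered, and (SP2) gives the Lyapunov condition. Since
`b` is a function of the `Y` and `Z` data only, the `ξᵢ` are still independent and centered given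
everything that determines `b`, and a conditional Chebyshev inequality bounds the `ξb` terms by
`E'_y`; the `ζa` terms are symmetric. Cauchy–Schwarz and the product rate handle `ab`. The sum of
the remainders and the sum of their squares must both be small, because they also enter the
normalization (`Learner.measure_remainder_le`, `exists_studentized_perturbation`).

Uniformity over laws costs nothing: the sequential statement is applied to a sequence of
near-maximizers of the rejection probability. -/

/-- Centered laws whose variances add up to one and whose absolute moments of order `2 + δ` add up
to at most `η`. -/
structure IsLyapunovArray {ι : Type*} [Fintype ι] (δ η : ℝ) (μ : ι → Measure ℝ) : Prop where
  isProb : ∀ i, IsProbabilityMeasure (μ i)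
  mean_zero : ∀ i, ∫ x, x ∂(μ i) = 0
  integrable : ∀ i, Integrable (fun x => |x| ^ (2 + δ)) (μ i)
  sum_var : ∑ i, ∫ x, x ^ 2 ∂(μ i) = 1
  sum_moment : ∑ i, ∫ x, |x| ^ (2 + δ) ∂(μ i) ≤ η

/-! ### Lyapunov central limit theorem by characteristic functions -/

theorem sq_le_add_rpow {κ δ : ℝ} (hκ : 0 < κ) (hδ : 0 < δ) (x : ℝ) :
    x ^ 2 ≤ κ ^ 2 + κ ^ (-δ) * |x| ^ (2 + δ) := by
  have h2 : x ^ 2 = |x| ^ 2 := (sq_abs x).symm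
  rcases le_total |x| κ with h | h
  · have : |x| ^ 2 ≤ κ ^ 2 := by gcongr
    have : 0 ≤ κ ^ (-δ) * |x| ^ (2 + δ) := by positivity
    linarith
  · have hx : 0 < |x| := hκ.trans_le h
    have h1 : 1 ≤ κ ^ (-δ) * |x| ^ δ := by
      rw [Real.rpow_neg hκ.le, ← div_eq_inv_mul, one_le_div (by positivity)]
      exact Real.rpow_le_rpow hκ.le h hδ.le
    have h3 : κ ^ (-δ) * |x| ^ (2 + δ) = |x| ^ 2 * (κ ^ (-δ) * |x| ^ δ) := by
      rw [Real.rpow_add hx, Real.rpow_two]; ring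
    rw [h3, h2]
    nlinarith [sq_nonneg κ, sq_nonneg |x|]

/-- Second-order Taylor expansion with only `2 + δ` moments to spend. Below `κ` the cubic remainder
is at most a multiple of `κ u²`; above `κ` the remainder is `O(u²)`, and `u²` is dominated by the `2
+ δ` power. The factor 4 absorbs the crude bound `2 + |u| + u²/2` for `|u| ≥ 1`. -/
theorem norm_exp_mul_I_sub_le {κ δ : ℝ} (hκ : 0 < κ) (hκ1 : κ ≤ 1) (hδ : 0 < δ) (u : ℝ) :
    ‖Complex.exp (u * Complex.I) - 1 - u * Complex.I + (u : ℂ) ^ 2 / 2‖ ≤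
      4 * (κ * u ^ 2 + κ ^ (-δ) * |u| ^ (2 + δ)) := by
  have hpos : 0 ≤ κ ^ (-δ) * |u| ^ (2 + δ) := by positivity
  have hI : (Complex.I) ^ 2 = -1 := Complex.I_sq
  have key : κ ≤ |u| → |u| ^ 2 ≤ κ ^ (-δ) * |u| ^ (2 + δ) := by
    intro h
    have hx : 0 < |u| := hκ.trans_le h
    have h1 : 1 ≤ κ ^ (-δ) * |u| ^ δ := by
      rw [Real.rpow_neg hκ.le, ← div_eq_inv_mul, one_le_div (by positivity)]
      exact Real.rpow_le_rpow hκ.le h hδ.le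
    have h3 : κ ^ (-δ) * |u| ^ (2 + δ) = |u| ^ 2 * (κ ^ (-δ) * |u| ^ δ) := by
      rw [Real.rpow_add hx, Real.rpow_two]; ring
    rw [h3]
    nlinarith [sq_nonneg |u|]
  have small : |u| ≤ 1 → ‖Complex.exp (u * Complex.I) - 1 - u * Complex.I + (u : ℂ) ^ 2 / 2‖ ≤
      3 * |u| ^ 3 := by
    intro h
    have := Complex.norm_exp_sub_sum_le_norm_mul_exp (u * Complex.I) 3
    simp only [Finset.sum_range_succ, Finset.sum_range_zero, Nat.factorial, norm_mul,
      Complex.norm_I, mul_one, Complex.norm_real, Real.norm_eq_abs, mul_pow, hI] at this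
    have e : Complex.exp (u * Complex.I) - 1 - u * Complex.I + (u : ℂ) ^ 2 / 2 =
        Complex.exp (↑u * Complex.I) - (0 + 1 * 1 / ((1 : ℕ) : ℂ) +
          (u : ℂ) ^ 1 * Complex.I ^ 1 / ((1 : ℕ) : ℂ) + (u : ℂ) ^ 2 * -1 / ((2 : ℕ) : ℂ)) := by
      push_cast; ring
    rw [e]
    have h3 : Real.exp |u| ≤ 3 := by
      calc Real.exp |u| ≤ Real.exp 1 := Real.exp_le_exp.mpr h
        _ ≤ 3 := by linarith [Real.exp_one_lt_d9]
    calc _ ≤ |u| ^ 3 * Real.exp |u| := by simpa using this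
      _ ≤ |u| ^ 3 * 3 := by gcongr
      _ = _ := by ring
  rcases le_total |u| κ with h | h
  · refine (small (h.trans hκ1)).trans ?_
    have : |u| ^ 3 ≤ κ * u ^ 2 := by
      rw [← sq_abs u, pow_succ, mul_comm]; gcongr
    nlinarith [sq_nonneg u, mul_nonneg hκ.le (sq_nonneg u)]
  · have hk := key h
    have hκu : 0 ≤ κ * u ^ 2 := by positivity
    rcases le_total |u| 1 with h1 | h1
    · refine (small h1).trans ?_
      have : |u| ^ 3 ≤ |u| ^ 2 := pow_le_pow_of_le_one (abs_nonneg u) h1 (by norm_num)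
      nlinarith
    · have n1 : ‖Complex.exp (u * Complex.I)‖ = 1 := Complex.norm_exp_ofReal_mul_I u
      have n2 : ‖(u : ℂ) * Complex.I‖ = |u| := by simp
      have n3 : ‖(u : ℂ) ^ 2 / 2‖ = |u| ^ 2 / 2 := by simp
      calc _ ≤ ‖Complex.exp (u * Complex.I)‖ + ‖(1 : ℂ)‖ + ‖(u : ℂ) * Complex.I‖ +
            ‖(u : ℂ) ^ 2 / 2‖ := by
            refine (norm_add_le _ _).trans ?_
            gcongr
            refine (norm_sub_le _ _).trans ?_
            gcongr
            exact norm_sub_le _ _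
        _ = 1 + 1 + |u| + |u| ^ 2 / 2 := by rw [n1, n2, n3]; simp
        _ ≤ _ := by nlinarith

theorem norm_prod_sub_prod_le {ι : Type*} (s : Finset ι) {f g : ι → ℂ}
    (hf : ∀ i, ‖f i‖ ≤ 1) (hg : ∀ i, ‖g i‖ ≤ 1) :
    ‖∏ i ∈ s, f i - ∏ i ∈ s, g i‖ ≤ ∑ i ∈ s, ‖f i - g i‖ := by
  classical
  induction s using Finset.induction_on with
  | empty => simp
  | insert a s ha ih =>
    rw [Finset.prod_insert ha, Finset.prod_insert ha, Finset.sum_insert ha]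
    have e : f a * ∏ i ∈ s, f i - g a * ∏ i ∈ s, g i =
        (f a - g a) * ∏ i ∈ s, f i + g a * (∏ i ∈ s, f i - ∏ i ∈ s, g i) := by ring
    rw [e]
    refine (norm_add_le _ _).trans ?_
    rw [norm_mul, norm_mul]
    have hp : ‖∏ i ∈ s, f i‖ ≤ 1 := by
      rw [norm_prod]; exact Finset.prod_le_one (fun i _ => norm_nonneg _) fun i _ => hf i
    have := hg a
    nlinarith [norm_nonneg (f a - g a), norm_nonneg (∏ i ∈ s, f i - ∏ i ∈ s, g i)]

theorem abs_exp_neg_sub_le {x : ℝ} (hx : 0 ≤ x) : |Real.exp (-x) - (1 - x)| ≤ x ^ 2 := by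
  have h1 := Real.add_one_le_exp (-x)
  rw [abs_of_nonneg (by linarith)]
  have h2 : Real.exp (-x) * (1 + x) ≤ 1 := by
    have := Real.add_one_le_exp x
    calc Real.exp (-x) * (1 + x) ≤ Real.exp (-x) * Real.exp x := by gcongr; linarith
      _ = 1 := by rw [← Real.exp_add]; simp
  have h3 : 0 < Real.exp (-x) := Real.exp_pos _
  nlinarith

namespace IsLyapunovArray

variable {ι : Type*} [Fintype ι] {δ η : ℝ} {μ : ι → Measure ℝ}

theorem integrable_sq (h : IsLyapunovArray δ η μ) (hδ : 0 < δ) (i : ι) :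
    Integrable (fun x : ℝ => x ^ 2) (μ i) := by
  have := h.isProb i
  refine ((integrable_const (1 : ℝ)).add (h.integrable i)).mono' (by fun_prop) ?_
  refine Eventually.of_forall fun x => ?_
  have := sq_le_add_rpow one_pos hδ x
  simpa using this

theorem integrable_id (h : IsLyapunovArray δ η μ) (hδ : 0 < δ) (i : ι) :
    Integrable (fun x : ℝ => x) (μ i) := by
  have := h.isProb i
  refine ((integrable_const (1 : ℝ)).add (h.integrable_sq hδ i)).mono' (by fun_prop) ?_
  refine Eventually.of_forall fun x => ?_
  simp only [Real.norm_eq_abs, Pi.add_apply]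
  nlinarith [sq_abs x, sq_nonneg (|x| - 1)]

/-- Both terms are compared with `1 - t² v / 2`, where `v` is the variance: the first by integrating
the Taylor bound, the second by the expansion of the real exponential. -/
theorem norm_charFun_sub_le (h : IsLyapunovArray δ η μ) (hδ : 0 < δ) {κ : ℝ} (hκ : 0 < κ)
    (hκ1 : κ ≤ 1) (t : ℝ) (i : ι) :
    ‖charFun (μ i) t - Complex.exp (-(t ^ 2 * (∫ x, x ^ 2 ∂(μ i)) / 2 : ℝ))‖ ≤
      4 * (κ * t ^ 2 * (∫ x, x ^ 2 ∂(μ i)) +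
        κ ^ (-δ) * |t| ^ (2 + δ) * ∫ x, |x| ^ (2 + δ) ∂(μ i)) +
      (t ^ 2 * (∫ x, x ^ 2 ∂(μ i)) / 2) ^ 2 := by
  have := h.isProb i
  have h2 := h.integrable_sq hδ i
  have h1 := h.integrable_id hδ i
  set v := ∫ x, x ^ 2 ∂(μ i) with hv
  have hv0 : 0 ≤ v := integral_nonneg fun x => sq_nonneg x
  have iexp : Integrable (fun x : ℝ => Complex.exp (((t * x : ℝ) : ℂ) * Complex.I)) (μ i) := by
    refine (integrable_const (1 : ℝ)).mono' (by fun_prop) (Eventually.of_forall fun x => ?_)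
    rw [Complex.norm_exp_ofReal_mul_I]
  have i1 : Integrable (fun x : ℝ => ((t * x : ℝ) : ℂ) * Complex.I) (μ i) :=
    ((h1.const_mul t).ofReal (𝕜 := ℂ)).mul_const _
  have i2 : Integrable (fun x : ℝ => ((t * x : ℝ) : ℂ) ^ 2 / 2) (μ i) := by
    refine (((h2.const_mul (t ^ 2)).ofReal (𝕜 := ℂ)).div_const 2).congr
      (Eventually.of_forall fun x => ?_)
    simp only [Complex.coe_algebraMap, RCLike.ofReal_mul, RCLike.ofReal_pow, mul_pow,
      Complex.ofReal_mul]
  have e1 : ∫ x, ((t * x : ℝ) : ℂ) * Complex.I ∂(μ i) = 0 := by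
    rw [integral_mul_const, integral_complex_ofReal, integral_const_mul, h.mean_zero i]; simp
  have e2 : ∫ x, ((t * x : ℝ) : ℂ) ^ 2 / 2 ∂(μ i) = ((t ^ 2 * v / 2 : ℝ) : ℂ) := by
    have : ∀ x : ℝ, ((t * x : ℝ) : ℂ) ^ 2 / 2 = ((t ^ 2 * x ^ 2 / 2 : ℝ) : ℂ) := fun x => by
      push_cast; ring
    simp_rw [this]
    rw [integral_complex_ofReal, integral_div, integral_const_mul]
  have hint : charFun (μ i) t - ((1 - t ^ 2 * v / 2 : ℝ) : ℂ) =
      ∫ x, (Complex.exp (((t * x : ℝ) : ℂ) * Complex.I) - 1 - ((t * x : ℝ) : ℂ) * Complex.I +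
        ((t * x : ℝ) : ℂ) ^ 2 / 2) ∂(μ i) := by
    have h3 := integral_add ((iexp.sub (integrable_const 1)).sub i1) i2
    have h4 := integral_sub (iexp.sub (integrable_const 1)) i1
    simp only [Pi.sub_apply] at h3 h4
    rw [h3, h4, integral_sub iexp (integrable_const 1), e1, e2, charFun_apply_real]
    simp
    ring
  have hA : ‖charFun (μ i) t - ((1 - t ^ 2 * v / 2 : ℝ) : ℂ)‖ ≤
      4 * (κ * t ^ 2 * v + κ ^ (-δ) * |t| ^ (2 + δ) * ∫ x, |x| ^ (2 + δ) ∂(μ i)) := by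
    rw [hint]
    have hb : ∀ x : ℝ, ‖Complex.exp (((t * x : ℝ) : ℂ) * Complex.I) - 1 -
        ((t * x : ℝ) : ℂ) * Complex.I + ((t * x : ℝ) : ℂ) ^ 2 / 2‖ ≤
        4 * (κ * t ^ 2 * x ^ 2 + κ ^ (-δ) * |t| ^ (2 + δ) * |x| ^ (2 + δ)) := fun x => by
      refine (norm_exp_mul_I_sub_le hκ hκ1 hδ (t * x)).trans (le_of_eq ?_)
      rw [abs_mul, Real.mul_rpow (abs_nonneg t) (abs_nonneg x)]
      ring
    refine (norm_integral_le_of_norm_le ?_ (Eventually.of_forall hb)).trans (le_of_eq ?_)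
    · exact (((h2.const_mul _).add ((h.integrable i).const_mul _)).const_mul 4)
    · rw [integral_const_mul, integral_add (h2.const_mul _) ((h.integrable i).const_mul _),
        integral_const_mul, integral_const_mul]
  have hB : ‖((1 - t ^ 2 * v / 2 : ℝ) : ℂ) - Complex.exp (-(t ^ 2 * v / 2 : ℝ))‖ ≤
      (t ^ 2 * v / 2) ^ 2 := by
    have : Complex.exp (-(t ^ 2 * v / 2 : ℝ)) = ((Real.exp (-(t ^ 2 * v / 2)) : ℝ) : ℂ) := by
      push_cast; rfl
    rw [this, ← Complex.ofReal_sub, Complex.norm_real, Real.norm_eq_abs, abs_sub_comm]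
    exact abs_exp_neg_sub_le (by positivity)
  calc _ = ‖(charFun (μ i) t - ((1 - t ^ 2 * v / 2 : ℝ) : ℂ)) +
        (((1 - t ^ 2 * v / 2 : ℝ) : ℂ) - Complex.exp (-(t ^ 2 * v / 2 : ℝ)))‖ := by
        congr 1; ring
    _ ≤ _ := (norm_add_le _ _).trans (add_le_add hA hB)

/-- The one-variable errors add up by telescoping the product. The squared variances are summable to
something small because the largest variance is at most `κ + κ ^ (-δ) * η` while the variances sum
to one. The parameter `κ` stays free: it is fixed first, and then `η` is sent to zero. -/
theorem norm_charFun_sum_sub_le (h : IsLyapunovArray δ η μ) (hδ : 0 < δ) {κ : ℝ} (hκ : 0 < κ)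
    (hκ1 : κ ≤ 1) (t : ℝ) :
    ‖charFun ((Measure.pi μ).map fun x => ∑ i, x i) t - Complex.exp (-(t : ℂ) ^ 2 / 2)‖ ≤
      (4 * t ^ 2 + 4 * |t| ^ (2 + δ) + t ^ 4) * (κ + κ ^ (-δ) * η) := by
  have := h.isProb
  have hm0 : ∀ i, 0 ≤ ∫ x, |x| ^ (2 + δ) ∂(μ i) := fun i =>
    integral_nonneg fun x => by positivity
  have hv0 : ∀ i, 0 ≤ ∫ x, x ^ 2 ∂(μ i) := fun i => integral_nonneg fun x => sq_nonneg x
  have hk0 : 0 < κ ^ (-δ) := Real.rpow_pos_of_pos hκ _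
  have hη : 0 ≤ η := (Finset.sum_nonneg fun i _ => hm0 i).trans h.sum_moment
  have hvle : ∀ i, ∫ x, x ^ 2 ∂(μ i) ≤ κ + κ ^ (-δ) * η := fun i => by
    have h1 : ∫ x, x ^ 2 ∂(μ i) ≤ ∫ x, (κ ^ 2 + κ ^ (-δ) * |x| ^ (2 + δ)) ∂(μ i) :=
      integral_mono (h.integrable_sq hδ i)
        ((integrable_const _).add ((h.integrable i).const_mul _)) fun x => sq_le_add_rpow hκ hδ x
    rw [integral_add (integrable_const _) ((h.integrable i).const_mul _),
      integral_const_mul] at h1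
    simp only [integral_const, probReal_univ, smul_eq_mul, one_mul] at h1
    have h2 : ∫ x, |x| ^ (2 + δ) ∂(μ i) ≤ η :=
      (Finset.single_le_sum (f := fun i => ∫ x, |x| ^ (2 + δ) ∂(μ i))
        (fun i _ => hm0 i) (Finset.mem_univ i)).trans h.sum_moment
    have h3 : κ ^ (-δ) * ∫ x, |x| ^ (2 + δ) ∂(μ i) ≤ κ ^ (-δ) * η := by gcongr
    nlinarith
  have e : Complex.exp (-(t : ℂ) ^ 2 / 2) =
      ∏ i, Complex.exp (-(t ^ 2 * (∫ x, x ^ 2 ∂(μ i)) / 2 : ℝ)) := by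
    rw [← Complex.exp_sum]
    congr 1
    rw [Finset.sum_neg_distrib, ← Complex.ofReal_sum, ← Finset.sum_div, ← Finset.mul_sum,
      h.sum_var]
    push_cast; ring
  rw [charFun_map_sum_pi_eq_prod, Finset.prod_apply, e]
  refine (norm_prod_sub_prod_le _ (fun i => norm_charFun_le_one t) fun i => ?_).trans ?_
  · rw [← Complex.ofReal_neg, ← Complex.ofReal_exp, Complex.norm_real, Real.norm_eq_abs,
      abs_of_pos (Real.exp_pos _)]
    refine Real.exp_le_one_iff.mpr ?_
    have := hv0 i
    have : 0 ≤ t ^ 2 * ∫ x, x ^ 2 ∂(μ i) := by positivity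
    linarith
  · refine (Finset.sum_le_sum fun i _ => h.norm_charFun_sub_le hδ hκ hκ1 t i).trans ?_
    have hlast : ∑ i, (t ^ 2 * (∫ x, x ^ 2 ∂(μ i)) / 2) ^ 2 ≤ t ^ 4 * (κ + κ ^ (-δ) * η) := by
      calc _ ≤ ∑ i, (t ^ 4 * (κ + κ ^ (-δ) * η)) * ∫ x, x ^ 2 ∂(μ i) := by
            refine Finset.sum_le_sum fun i _ => ?_
            have h1 := hvle i
            have h2 := hv0 i
            have : (∫ x, x ^ 2 ∂(μ i)) ^ 2 ≤ (κ + κ ^ (-δ) * η) * ∫ x, x ^ 2 ∂(μ i) := by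
              rw [sq]; gcongr
            calc (t ^ 2 * (∫ x, x ^ 2 ∂(μ i)) / 2) ^ 2
                = t ^ 4 * ((∫ x, x ^ 2 ∂(μ i)) ^ 2) / 4 := by ring
              _ ≤ t ^ 4 * ((∫ x, x ^ 2 ∂(μ i)) ^ 2) := by
                have : 0 ≤ t ^ 4 * ((∫ x, x ^ 2 ∂(μ i)) ^ 2) := by positivity
                linarith
              _ ≤ t ^ 4 * ((κ + κ ^ (-δ) * η) * ∫ x, x ^ 2 ∂(μ i)) := by gcongr
              _ = _ := by ring
        _ = _ := by rw [← Finset.mul_sum, h.sum_var, mul_one]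
    rw [Finset.sum_add_distrib, ← Finset.mul_sum, Finset.sum_add_distrib, ← Finset.mul_sum,
      ← Finset.mul_sum, h.sum_var]
    have hmom : κ ^ (-δ) * |t| ^ (2 + δ) * ∑ i, ∫ x, |x| ^ (2 + δ) ∂(μ i) ≤
        κ ^ (-δ) * |t| ^ (2 + δ) * η := by
      have := h.sum_moment
      gcongr
    have p1 : 0 ≤ t ^ 2 * (κ ^ (-δ) * η) := by positivity
    have p2 : 0 ≤ |t| ^ (2 + δ) * κ := by positivity
    nlinarith

end IsLyapunovArray

theorem tendsto_charFun_of_isLyapunovArray {δ : ℝ} (hδ : 0 < δ) {n : ℕ → ℕ}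
    {μ : ∀ k, Fin (n k) → Measure ℝ} {η : ℕ → ℝ} (hη : Tendsto η atTop (𝓝 0))
    (h : ∀ k, IsLyapunovArray δ (η k) (μ k)) (t : ℝ) :
    Tendsto (fun k => charFun ((Measure.pi (μ k)).map fun x => ∑ i, x i) t) atTop
      (𝓝 (Complex.exp (-(t : ℂ) ^ 2 / 2))) := by
  rw [tendsto_iff_norm_sub_tendsto_zero, Metric.tendsto_nhds]
  intro ε hε
  set K := 4 * t ^ 2 + 4 * |t| ^ (2 + δ) + t ^ 4
  have hK : 0 ≤ K := by positivity
  set κ := min 1 (ε / (2 * (K + 1)))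
  have hκ : 0 < κ := lt_min one_pos (by positivity)
  have hκ1 : κ ≤ 1 := min_le_left _ _
  have hκ2 : κ ≤ ε / (2 * (K + 1)) := min_le_right _ _
  have lim : Tendsto (fun k => κ ^ (-δ) * η k) atTop (𝓝 0) := by
    simpa using hη.const_mul (κ ^ (-δ))
  filter_upwards [lim.eventually_lt_const (show 0 < ε / (2 * (K + 1)) by positivity)] with k hk
  rw [Real.dist_eq, sub_zero, abs_of_nonneg (norm_nonneg _)]
  refine ((h k).norm_charFun_sum_sub_le hδ hκ hκ1 t).trans_lt ?_
  calc K * (κ + κ ^ (-δ) * η k) ≤ K * (ε / (2 * (K + 1)) + ε / (2 * (K + 1))) := by gcongr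
    _ = ε * (K / (K + 1)) := by field_simp; ring
    _ < ε * 1 := by
      have : K / (K + 1) < 1 := by rw [div_lt_one (by positivity)]; linarith
      gcongr
    _ = ε := mul_one ε

/-- The central limit theorem, uniformly over arrays with small Lyapunov ratio. -/
theorem exists_lyapunov_clt {δ ε : ℝ} (hδ : 0 < δ) (hε : 0 < ε) (t : ℝ) :
    ∃ η : ℝ, 0 < η ∧ ∀ (n : ℕ) (μ : Fin n → Measure ℝ), IsLyapunovArray δ η μ →
      |(Measure.pi μ).real {x | ∑ i, x i ≤ t} - (gaussianReal 0 1).real (Set.Iic t)| < ε := by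
  -- If no `η` works, a bad array for each `η = 1 / (k + 1)` gives a sequence with vanishing
  -- Lyapunov ratio. Lévy's continuity theorem then contradicts badness, because the normal law does
  -- not charge the endpoint `t`. This yields uniformity without a rate.
  by_contra! hcon
  choose n μ hμ hbad using fun k : ℕ => hcon (1 / ((k : ℝ) + 1)) (by positivity)
  have hprob : ∀ k i, IsProbabilityMeasure (μ k i) := fun k i => (hμ k).isProb i
  have hmeas : ∀ k, Measurable fun x : Fin (n k) → ℝ => ∑ i, x i := fun k => by fun_prop
  let P : ℕ → ProbabilityMeasure ℝ := fun k =>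
    ⟨(Measure.pi (μ k)).map fun x => ∑ i, x i, Measure.isProbabilityMeasure_map (by fun_prop)⟩
  let G : ProbabilityMeasure ℝ := ⟨gaussianReal 0 1, inferInstance⟩
  have hPG : Tendsto P atTop (𝓝 G) := by
    refine ProbabilityMeasure.tendsto_iff_tendsto_charFun.2 fun s => ?_
    have := tendsto_charFun_of_isLyapunovArray hδ tendsto_one_div_add_atTop_nhds_zero_nat hμ s
    simpa [P, G, charFun_gaussianReal, neg_div] using this
  have hG : (G : Measure ℝ) (frontier (Set.Iic t)) = 0 := by
    have : NullSingletonClass (gaussianReal 0 1) := nullSingletonClass_gaussianReal one_ne_zero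
    rw [frontier_Iic]
    exact measure_singleton (μ := gaussianReal 0 1) t
  have lim := (ENNReal.tendsto_toReal (measure_ne_top _ _)).comp
    (ProbabilityMeasure.tendsto_measure_of_null_frontier_of_tendsto' hPG hG)
  rw [Metric.tendsto_nhds] at lim
  obtain ⟨k, hk⟩ := (lim ε hε).exists
  refine absurd hk (not_lt.mpr ?_)
  have e : (P k : Measure ℝ) (Set.Iic t) = Measure.pi (μ k) {x | ∑ i, x i ≤ t} := by
    change ((Measure.pi (μ k)).map fun x => ∑ i, x i) (Set.Iic t) = _
    rw [Measure.map_apply (hmeas k) measurableSet_Iic]; rfl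
  rw [Real.dist_eq]
  simp only [Function.comp_apply, e]
  exact hbad k

/-! ### Second-moment bounds and concentration of the sum of squares -/

theorem integral_sum_pi_sub_sq_le {ι : Type*} [Fintype ι] {μ : ι → Measure ℝ}
    [∀ i, IsProbabilityMeasure (μ i)] {X : ι → ℝ → ℝ} (hX : ∀ i, MemLp (X i) 2 (μ i)) :
    Integrable (fun x : ι → ℝ => (∑ i, X i (x i) - ∑ i, ∫ y, X i y ∂(μ i)) ^ 2) (Measure.pi μ) ∧
    ∫ x, (∑ i, X i (x i) - ∑ i, ∫ y, X i y ∂(μ i)) ^ 2 ∂(Measure.pi μ) ≤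
      ∑ i, ∫ y, X i y ^ 2 ∂(μ i) := by
  have hXi : ∀ i, MemLp (fun x : ι → ℝ => X i (x i)) 2 (Measure.pi μ) := fun i =>
    (hX i).comp_measurePreserving (measurePreserving_eval μ i)
  have hS : MemLp (fun x : ι → ℝ => ∑ i, X i (x i)) 2 (Measure.pi μ) :=
    memLp_finsetSum _ fun i _ => hXi i
  have hmean : ∫ x : ι → ℝ, ∑ i, X i (x i) ∂(Measure.pi μ) = ∑ i, ∫ y, X i y ∂(μ i) := by
    rw [integral_finsetSum _ fun i _ => (hXi i).integrable one_le_two]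
    exact Finset.sum_congr rfl fun i _ => integral_comp_eval (hX i).aestronglyMeasurable
  refine ⟨(hS.sub (memLp_const _)).integrable_sq, ?_⟩
  have hvar := variance_eq_integral hS.aestronglyMeasurable.aemeasurable
  rw [hmean] at hvar
  rw [← hvar]
  have e : (fun x : ι → ℝ => ∑ i, X i (x i)) = ∑ i, fun x : ι → ℝ => X i (x i) := by
    ext x; simp
  rw [e, variance_sum_pi hX]
  exact Finset.sum_le_sum fun i _ => variance_le_expectation_sq (hX i).aestronglyMeasurable

namespace IsLyapunovArray

variable {ι : Type*} [Fintype ι] {δ η : ℝ} {μ : ι → Measure ℝ}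

theorem measure_sq_sum_ge_le (h : IsLyapunovArray δ η μ) (hδ : 0 < δ) {κ : ℝ} (hκ : 0 < κ) :
    (Measure.pi μ).real {x | κ ≤ (∑ i, x i) ^ 2} ≤ 1 / κ := by
  have := h.isProb
  have hX : ∀ i, MemLp (fun x : ℝ => x) 2 (μ i) := fun i =>
    (memLp_two_iff_integrable_sq (by fun_prop)).2 (h.integrable_sq hδ i)
  obtain ⟨h1, h2⟩ := integral_sum_pi_sub_sq_le hX
  simp only [h.mean_zero, Finset.sum_const_zero, sub_zero, h.sum_var] at h1 h2
  rw [le_div_iff₀' hκ]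
  exact (mul_meas_ge_le_integral_of_nonneg (Eventually.of_forall fun x => sq_nonneg _) h1 κ).trans h2

/-- Fourth moments may be infinite, so `x²` is split into its part `f` on `[-τ, τ]` and the tail
`g`. The sum of the `f`-parts has variance at most `τ²`, since `f² ≤ τ² x²`; the tails have total
mean at most `τ ^ (-δ) * η`, counted once for the sum and once for its centering. -/
theorem measure_abs_sum_sq_sub_one_ge_le (h : IsLyapunovArray δ η μ) (hδ : 0 < δ) {κ τ : ℝ}
    (hκ : 0 < κ) (hτ : 0 < τ) :
    (Measure.pi μ).real {x | κ ≤ |∑ i, x i ^ 2 - 1|} ≤ (τ + 2 * (τ ^ (-δ) * η)) / κ := by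
  have := h.isProb
  let f : ℝ → ℝ := (Set.Icc (-τ) τ).indicator fun x => x ^ 2
  let g : ℝ → ℝ := fun x => x ^ 2 - f x
  have hfm : Measurable f := (by fun_prop : Measurable fun x : ℝ => x ^ 2).indicator measurableSet_Icc
  have hf0 : ∀ x, 0 ≤ f x := fun x => Set.indicator_nonneg (fun x _ => sq_nonneg x) x
  have hfx : ∀ x, f x ≤ x ^ 2 := fun x =>
    Set.indicator_le_self' (fun x _ => sq_nonneg x) x
  have hfτ : ∀ x, f x ≤ τ ^ 2 := fun x => by
    refine Set.indicator_le' (fun y hy => ?_) (fun y _ => sq_nonneg τ) x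
    exact sq_le_sq' hy.1 hy.2
  have hg0 : ∀ x, 0 ≤ g x := fun x => sub_nonneg.mpr (hfx x)
  have hgle : ∀ x, g x ≤ τ ^ (-δ) * |x| ^ (2 + δ) := fun x => by
    by_cases hx : x ∈ Set.Icc (-τ) τ
    · have : g x = 0 := by simp [g, f, hx]
      rw [this]; positivity
    · have hgx : g x = x ^ 2 := by simp [g, f, hx]
      have hxτ : τ < |x| := by
        by_contra! hc
        exact hx (abs_le.mp hc)
      have hx0 : 0 < |x| := hτ.trans hxτ
      have h1 : 1 ≤ τ ^ (-δ) * |x| ^ δ := by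
        rw [Real.rpow_neg hτ.le, ← div_eq_inv_mul, one_le_div (by positivity)]
        exact Real.rpow_le_rpow hτ.le hxτ.le hδ.le
      have h3 : τ ^ (-δ) * |x| ^ (2 + δ) = |x| ^ 2 * (τ ^ (-δ) * |x| ^ δ) := by
        rw [Real.rpow_add hx0, Real.rpow_two]; ring
      rw [hgx, h3, ← sq_abs x]
      nlinarith [sq_nonneg |x|]
  have hfi : ∀ i, Integrable f (μ i) := fun i =>
    (h.integrable_sq hδ i).mono' hfm.aestronglyMeasurable
      (Eventually.of_forall fun x => by rw [Real.norm_eq_abs, abs_of_nonneg (hf0 x)]; exact hfx x)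
  have hgi : ∀ i, Integrable g (μ i) := fun i => (h.integrable_sq hδ i).sub (hfi i)
  have hf2 : ∀ i, Integrable (fun x => f x ^ 2) (μ i) := fun i =>
    ((hfi i).const_mul (τ ^ 2)).mono' (by fun_prop) (Eventually.of_forall fun x => by
      rw [Real.norm_eq_abs, abs_of_nonneg (sq_nonneg _), sq]
      exact mul_le_mul_of_nonneg_right (hfτ x) (hf0 x))
  have hfL : ∀ i, MemLp f 2 (μ i) := fun i =>
    (memLp_two_iff_integrable_sq hfm.aestronglyMeasurable).2 (hf2 i)
  obtain ⟨i1, v1⟩ := integral_sum_pi_sub_sq_le hfL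
  have v2 : ∑ i, ∫ y, f y ^ 2 ∂(μ i) ≤ τ ^ 2 := by
    calc _ ≤ ∑ i, τ ^ 2 * ∫ y, y ^ 2 ∂(μ i) := by
          refine Finset.sum_le_sum fun i _ => ?_
          rw [← integral_const_mul]
          refine integral_mono (hf2 i) ((h.integrable_sq hδ i).const_mul _) fun x => ?_
          simp only [sq (f x)]
          exact mul_le_mul (hfτ x) (hfx x) (hf0 x) (sq_nonneg τ)
      _ = _ := by rw [← Finset.mul_sum, h.sum_var, mul_one]
  have hgsum : ∑ i, ∫ y, g y ∂(μ i) ≤ τ ^ (-δ) * η := by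
    calc _ ≤ ∑ i, τ ^ (-δ) * ∫ y, |y| ^ (2 + δ) ∂(μ i) := by
          refine Finset.sum_le_sum fun i _ => ?_
          rw [← integral_const_mul]
          exact integral_mono (hgi i) ((h.integrable i).const_mul _) hgle
      _ ≤ _ := by
        rw [← Finset.mul_sum]
        have := h.sum_moment
        gcongr
  have hgint : Integrable (fun x : ι → ℝ => ∑ i, g (x i)) (Measure.pi μ) :=
    integrable_finsetSum _ fun i _ => integrable_comp_eval (hgi i)
  have hgE : ∫ x : ι → ℝ, ∑ i, g (x i) ∂(Measure.pi μ) = ∑ i, ∫ y, g y ∂(μ i) := by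
    rw [integral_finsetSum _ fun i _ => integrable_comp_eval (hgi i)]
    exact Finset.sum_congr rfl fun i _ => integral_comp_eval (hgi i).aestronglyMeasurable
  have hsum : ∑ i, ∫ y, f y ∂(μ i) + ∑ i, ∫ y, g y ∂(μ i) = 1 := by
    rw [← Finset.sum_add_distrib, ← h.sum_var]
    refine Finset.sum_congr rfl fun i _ => ?_
    rw [← integral_add (hfi i) (hgi i)]
    simp [g]
  set F : (ι → ℝ) → ℝ := fun x => ∑ i, f (x i) - ∑ i, ∫ y, f y ∂(μ i)
  set M : (ι → ℝ) → ℝ := fun x =>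
    (τ⁻¹ * F x ^ 2 / 2 + τ / 2) + (∑ i, g (x i) + ∑ i, ∫ y, g y ∂(μ i))
  have i2 : Integrable (fun x => τ⁻¹ * F x ^ 2 / 2) (Measure.pi μ) := (i1.const_mul _).div_const 2
  have i3 : Integrable (fun x => τ⁻¹ * F x ^ 2 / 2 + τ / 2) (Measure.pi μ) :=
    i2.add (integrable_const _)
  have i4 : Integrable (fun x : ι → ℝ => ∑ i, g (x i) + ∑ i, ∫ y, g y ∂(μ i)) (Measure.pi μ) :=
    hgint.add (integrable_const _)
  have hMint : Integrable M (Measure.pi μ) := i3.add i4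
  have hbound : ∀ x : ι → ℝ, |∑ i, x i ^ 2 - 1| ≤ M x := fun x => by
    have e : ∑ i, x i ^ 2 - 1 = F x + ∑ i, g (x i) - ∑ i, ∫ y, g y ∂(μ i) := by
      have : ∑ i, x i ^ 2 = ∑ i, f (x i) + ∑ i, g (x i) := by
        rw [← Finset.sum_add_distrib]; simp [g]
      simp only [F]
      linarith
    -- The arithmetic–geometric mean inequality with weight `τ` turns the variance bound `τ²` into a
    -- first-moment bound `τ`.
    have b1 : |F x| ≤ τ⁻¹ * F x ^ 2 / 2 + τ / 2 := by
      have : 0 ≤ τ⁻¹ * (|F x| - τ) ^ 2 := by positivity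
      have e2 : τ⁻¹ * (|F x| - τ) ^ 2 = τ⁻¹ * F x ^ 2 + τ - 2 * |F x| := by
        rw [sub_sq, sq_abs]; field_simp; ring
      linarith
    have b2 : 0 ≤ ∑ i, g (x i) := Finset.sum_nonneg fun i _ => hg0 _
    have b3 : 0 ≤ ∑ i, ∫ y, g y ∂(μ i) := Finset.sum_nonneg fun i _ => integral_nonneg hg0
    rw [e]
    have := abs_le.mp b1
    simp only [M]
    rw [abs_le]
    constructor <;> linarith [this.1, this.2]
  have hMval : ∫ x, M x ∂(Measure.pi μ) ≤ τ + 2 * (τ ^ (-δ) * η) := by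
    have e : ∫ x, M x ∂(Measure.pi μ) = (τ⁻¹ * (∫ x, F x ^ 2 ∂(Measure.pi μ)) / 2 + τ / 2) +
        (∑ i, ∫ y, g y ∂(μ i) + ∑ i, ∫ y, g y ∂(μ i)) := by
      simp only [M]
      rw [integral_add i3 i4, integral_add i2 (integrable_const _),
        integral_add hgint (integrable_const _), integral_div, integral_const_mul, hgE]
      simp
    rw [e]
    have : τ⁻¹ * (∫ x, F x ^ 2 ∂(Measure.pi μ)) ≤ τ := by
      calc _ ≤ τ⁻¹ * τ ^ 2 := by
            have := v1.trans v2
            gcongr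
        _ = τ := by field_simp
    linarith
  rw [le_div_iff₀' hκ]
  calc κ * (Measure.pi μ).real {x | κ ≤ |∑ i, x i ^ 2 - 1|}
      ≤ κ * (Measure.pi μ).real {x | κ ≤ M x} := by
        refine mul_le_mul_of_nonneg_left (measureReal_mono ?_) hκ.le
        exact fun x hx => le_trans hx (hbound x)
    _ ≤ ∫ x, M x ∂(Measure.pi μ) := mul_meas_ge_le_integral_of_nonneg
        (Eventually.of_forall fun x => (abs_nonneg _).trans (hbound x)) hMint κ
    _ ≤ _ := hMval

end IsLyapunovArray

/-! ### Studentized sums under normalization and perturbation -/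

/-- The studentized sum `n ^ (-1/2) ∑ᵢ wᵢ / empVar(w) ^ (1/2)`. -/
def studentized {n : ℕ} (w : Fin n → ℝ) : ℝ := ((√(n : ℝ))⁻¹ * ∑ i, w i) / √(empVar w)

/-- Scale invariance: the unknown standard deviation `s` cancels between numerator and denominator.
-/
theorem studentized_eq {n : ℕ} (hn : 1 ≤ n) {s : ℝ} (hs : 0 < s) {v w : Fin n → ℝ}
    (h : ∀ i, w i = √(n : ℝ) * s * v i) :
    studentized w = (∑ i, v i) / √(∑ i, v i ^ 2 - (n : ℝ)⁻¹ * (∑ i, v i) ^ 2) := by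
  have hn0 : (0 : ℝ) < n := by exact_mod_cast hn
  have hq : √(n : ℝ) ^ 2 = n := Real.sq_sqrt hn0.le
  have hq0 : 0 < √(n : ℝ) := Real.sqrt_pos.mpr hn0
  have e1 : ∑ i, w i = √(n : ℝ) * s * ∑ i, v i := by
    rw [Finset.mul_sum]; exact Finset.sum_congr rfl fun i _ => h i
  have e2 : ∑ i, w i ^ 2 = n * s ^ 2 * ∑ i, v i ^ 2 := by
    rw [Finset.mul_sum]
    refine Finset.sum_congr rfl fun i _ => ?_
    rw [h i, mul_pow, mul_pow, hq]
  have e3 : empVar w = s ^ 2 * (∑ i, v i ^ 2 - (n : ℝ)⁻¹ * (∑ i, v i) ^ 2) := by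
    rw [empVar, e1, e2, mul_pow, mul_pow, mul_pow, hq]
    field_simp
  have e4 : (√(n : ℝ))⁻¹ * ∑ i, w i = s * ∑ i, v i := by
    rw [e1]; field_simp
  rw [studentized, e3, e4, Real.sqrt_mul (sq_nonneg s), Real.sqrt_sq hs.le,
    mul_div_mul_left _ _ hs.ne']

/-- The normalization of a studentized sum, and a small perturbation of the summands, move it by
little. -/
theorem exists_studentized_perturbation (t : ℝ) {ρ : ℝ} (hρ : 0 < ρ) :
    ∃ κ : ℝ, 0 < κ ∧ ∀ (n : ℕ) (v r : Fin n → ℝ), 1 ≤ n →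
      |∑ i, v i ^ 2 - 1| ≤ κ → (∑ i, v i) ^ 2 ≤ κ * n → ∑ i, r i ^ 2 ≤ κ → |∑ i, r i| ≤ κ →
      ((∑ i, (v i + r i)) / √(∑ i, (v i + r i) ^ 2 - (n : ℝ)⁻¹ * (∑ i, (v i + r i)) ^ 2) ≤ t →
        ∑ i, v i ≤ t + ρ) ∧
      (t < (∑ i, (v i + r i)) / √(∑ i, (v i + r i) ^ 2 - (n : ℝ)⁻¹ * (∑ i, (v i + r i)) ^ 2) →
        t - ρ < ∑ i, v i) := by
  -- `τ` is the tolerance for the denominator: moving `√D` by `τ` moves the threshold `t * √D` by at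
  -- most `ρ / 2`. The other half of `ρ` is left for the sum of the perturbations.
  set τ : ℝ := min (1 / 2) (ρ / (2 * (|t| + 1))) with hτ
  have hτ0 : 0 < τ := lt_min (by norm_num) (by positivity)
  have hτ1 : τ ≤ 1 / 2 := min_le_left _ _
  have hτ2 : |t| * τ ≤ ρ / 2 := by
    calc |t| * τ ≤ |t| * (ρ / (2 * (|t| + 1))) := by gcongr; exact min_le_right _ _
      _ = ρ / 2 * (|t| / (|t| + 1)) := by field_simp
      _ ≤ ρ / 2 * 1 := by
        have : |t| / (|t| + 1) ≤ 1 := by rw [div_le_one (by positivity)]; linarith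
        gcongr
      _ = _ := mul_one _
  -- The witness is `κ = q²`, so that the Cauchy–Schwarz cross term is of order `q`. From below, `D`
  -- loses at most `q²` from the squares, `4q` from the cross term and `4q²` from the squared mean,
  -- hence at most `9q ≤ τ`.
  set q : ℝ := min (min 1 (τ / 9)) (ρ / 2) with hq
  have hq0 : 0 < q := lt_min (lt_min one_pos (by positivity)) (by positivity)
  have hq1 : q ≤ 1 := (min_le_left _ _).trans (min_le_left _ _)
  have hq2 : 9 * q ≤ τ := by
    have : q ≤ τ / 9 := (min_le_left _ _).trans (min_le_right _ _)
    linarith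
  have hq3 : q ≤ ρ / 2 := min_le_right _ _
  have hqq : q ^ 2 ≤ q := by nlinarith
  refine ⟨q ^ 2, by positivity, fun n v r hn hv hs hr2 hr => ?_⟩
  have hn0 : (1 : ℝ) ≤ n := by exact_mod_cast hn
  set S := ∑ i, v i with hS
  set Rs := ∑ i, r i with hRs
  set C := ∑ i, v i * r i with hC
  set Q := ∑ i, v i ^ 2 with hQ
  set U := ∑ i, r i ^ 2 with hU
  have hU0 : 0 ≤ U := Finset.sum_nonneg fun i _ => sq_nonneg _
  have hCS : C ^ 2 ≤ Q * U := Finset.sum_mul_sq_le_sq_mul_sq _ _ _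
  have e1 : ∑ i, (v i + r i) = S + Rs := Finset.sum_add_distrib
  have e2 : ∑ i, (v i + r i) ^ 2 = Q + 2 * C + U := by
    rw [hQ, hC, hU, Finset.mul_sum, ← Finset.sum_add_distrib, ← Finset.sum_add_distrib]
    exact Finset.sum_congr rfl fun i _ => by ring
  rw [e1, e2]
  set D := Q + 2 * C + U - (n : ℝ)⁻¹ * (S + Rs) ^ 2 with hD
  have hv' := abs_le.mp hv
  have hC2 : |C| ≤ 2 * q := by
    refine abs_le_of_sq_le_sq ?_ (by positivity)
    have : Q * U ≤ 2 * q ^ 2 := mul_le_mul (by linarith [hv'.2]) hr2 hU0 (by norm_num)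
    nlinarith only [this, hCS, sq_nonneg q]
  have hC' := abs_le.mp hC2
  have hRs2 : Rs ^ 2 ≤ q ^ 2 := by
    rw [← sq_abs]
    have : |Rs| ^ 2 ≤ (q ^ 2) ^ 2 := by gcongr
    nlinarith only [sq_nonneg q, this, hqq, hq1, hq0]
  have hmean : (n : ℝ)⁻¹ * (S + Rs) ^ 2 ≤ 4 * q ^ 2 := by
    rw [inv_mul_le_iff₀ (by linarith)]
    nlinarith only [sq_nonneg (S - Rs), sq_nonneg q, hs, hRs2, hn0]
  have hmean0 : 0 ≤ (n : ℝ)⁻¹ * (S + Rs) ^ 2 := by positivity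
  have hDl : 1 - τ ≤ D := by linarith [hv'.1, hC'.1]
  have hDu : D ≤ 1 + τ := by linarith [hv'.2, hC'.2]
  have hD0 : 0 < D := by linarith
  have hsq : √D ^ 2 = D := Real.sq_sqrt hD0.le
  have hsq0 : 0 < √D := Real.sqrt_pos.mpr hD0
  have hsl : 1 - τ ≤ √D := Real.le_sqrt_of_sq_le (by nlinarith only [hDl, hτ0, hτ1])
  have hsu : √D ≤ 1 + τ := Real.sqrt_le_iff.mpr ⟨by linarith, by nlinarith only [hDu, hτ0]⟩
  have hts : |t * √D - t| ≤ ρ / 2 := by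
    have : t * √D - t = t * (√D - 1) := by ring
    rw [this, abs_mul]
    refine le_trans ?_ hτ2
    gcongr
    rw [abs_le]; constructor <;> linarith
  have hts' := abs_le.mp hts
  have hr' := abs_le.mp hr
  constructor
  · intro h
    rw [div_le_iff₀ hsq0] at h
    linarith [hts'.2, hr'.1]
  · intro h
    rw [lt_div_iff₀ hsq0] at h
    linarith [hts'.1, hr'.2]

/-- The law of large numbers for the normalization of a studentized sum, uniformly over arrays with
small Lyapunov ratio. -/
theorem exists_lyapunov_lln {δ ε κ : ℝ} (hδ : 0 < δ) (hε : 0 < ε) (hκ : 0 < κ) :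
    ∃ η : ℝ, 0 < η ∧ ∀ (n : ℕ) (μ : Fin n → Measure ℝ), 2 / (ε * κ) ≤ n → IsLyapunovArray δ η μ →
      (Measure.pi μ).real {x | ¬ (|∑ i, x i ^ 2 - 1| ≤ κ ∧ (∑ i, x i) ^ 2 ≤ κ * n)} ≤ ε := by
  set τ := ε * κ / 4 with hτ
  have hτ0 : 0 < τ := by positivity
  -- With `τ = ε κ / 4`, this `η` makes the bound for the sum of squares exactly `ε / 2`; the lower
  -- bound on `n` makes the Chebyshev bound for the sum at most `ε / 2`.
  refine ⟨τ ^ δ * (ε * κ / 8), by positivity, fun n μ hn h => ?_⟩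
  have := h.isProb
  have hn0 : 0 < (n : ℝ) := lt_of_lt_of_le (by positivity) hn
  have h1 := h.measure_abs_sum_sq_sub_one_ge_le hδ hκ hτ0
  have h2 := h.measure_sq_sum_ge_le hδ (show 0 < κ * n by positivity)
  have e1 : (τ + 2 * (τ ^ (-δ) * (τ ^ δ * (ε * κ / 8)))) / κ = ε / 2 := by
    have : τ ^ (-δ) * (τ ^ δ * (ε * κ / 8)) = ε * κ / 8 := by
      rw [← mul_assoc, ← Real.rpow_add hτ0]; simp
    rw [this, hτ]; field_simp; norm_num
  have e2 : 1 / (κ * n) ≤ ε / 2 := by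
    rw [div_le_iff₀ (by positivity)] at hn
    rw [div_le_div_iff₀ (by positivity) (by norm_num)]
    nlinarith
  calc _ ≤ (Measure.pi μ).real ({x | κ ≤ |∑ i, x i ^ 2 - 1|} ∪ {x | κ * n ≤ (∑ i, x i) ^ 2}) := by
        refine measureReal_mono fun x hx => ?_
        by_contra hc
        simp only [Set.mem_union, Set.mem_ofPred_eq, not_or, not_le] at hc hx
        exact hx ⟨hc.1.le, hc.2.le⟩
    _ ≤ _ := measureReal_union_le _ _
    _ ≤ ε / 2 + ε / 2 := add_le_add (h1.trans e1.le) (h2.trans e2)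
    _ = ε := add_halves ε

/-! ### Residuals of one observation under conditional independence -/

/-- The residual of `V` from its conditional mean given `Z`. -/
def resid {p : ℕ} (L : ProbabilityMeasure (Obs p)) (V : Obs p → ℝ) (o : Obs p) : ℝ :=
  V o - condMean L V (obsZ o)

/-- Conditional independence of `V` and `U` given `Z`. -/
abbrev CondIndepGivenZ {p : ℕ} (L : ProbabilityMeasure (Obs p)) (V U : Obs p → ℝ) : Prop :=
  CondIndepFun (MeasurableSpace.comap obsZ inferInstance) measurable_obsZ.comap_le V U
    (L : Measure (Obs p))

theorem measurable_integral_kernel {α : Type*} [MeasurableSpace α] (κ : Kernel α ℝ)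
    [IsMarkovKernel κ] : Measurable fun a => ∫ x, x ∂(κ a) :=
  (StronglyMeasurable.integral_kernel (f := fun x : ℝ => x) (κ := κ)
    measurable_id.stronglyMeasurable).measurable

theorem measurable_evariance_kernel {α : Type*} [MeasurableSpace α] (κ : Kernel α ℝ)
    [IsMarkovKernel κ] : Measurable fun a => evariance id (κ a) := by
  have hm := measurable_integral_kernel κ
  simp_rw [evariance_eq_lintegral_ofReal, id_eq]
  exact Measurable.lintegral_kernel_prod_right'
    (f := fun q : α × ℝ => ENNReal.ofReal ((q.2 - ∫ x, x ∂(κ q.1)) ^ 2))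
    ((measurable_snd.sub (hm.comp measurable_fst)).pow_const 2).ennreal_ofReal

section

variable {p : ℕ} (L : ProbabilityMeasure (Obs p)) {V U : Obs p → ℝ}

@[fun_prop]
theorem measurable_condMean (V : Obs p → ℝ) : Measurable (condMean L V) :=
  measurable_integral_kernel _

@[fun_prop]
theorem measurable_condVar (V : Obs p → ℝ) : Measurable (condVar L V) :=
  measurable_evariance_kernel _

theorem measurable_resid (hV : Measurable V) : Measurable (resid L V) :=
  hV.sub ((measurable_condMean L V).comp measurable_obsZ)

theorem condVar_eq (V : Obs p → ℝ) (z : Fin p → ℝ) :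
    condVar L V z = ∫⁻ v, ENNReal.ofReal ((v - condMean L V z) ^ 2)
      ∂(condDistrib V obsZ (L : Measure (Obs p)) z) := by
  rw [condVar, evariance_eq_lintegral_ofReal]; rfl

variable {L}

/-- Conditional independence in disintegrated form: given `(Z, U)`, the law of `V` ignores `U`. This
is how the null hypothesis enters the computations. -/
theorem CondIndepGivenZ.map_eq_compProd (h : CondIndepGivenZ L V U) (hV : Measurable V)
    (hU : Measurable U) :
    (L : Measure (Obs p)).map (fun o => ((obsZ o, U o), V o)) =
      (L : Measure (Obs p)).map (fun o => (obsZ o, U o)) ⊗ₘ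
        (condDistrib V obsZ (L : Measure (Obs p))).prodMkRight ℝ := by
  rw [← condDistrib_ae_eq_iff_measure_eq_compProd _ hV.aemeasurable]
  exact (condIndepFun_iff_condDistrib_prod_ae_eq_prodMkRight hV hU measurable_obsZ).1 h.symm

theorem CondIndepGivenZ.lintegral_resid_sq_mul (h : CondIndepGivenZ L V U) (hV : Measurable V)
    (hU : Measurable U) {g : (Fin p → ℝ) × ℝ → ℝ≥0∞} (hg : Measurable g) :
    ∫⁻ o, ENNReal.ofReal (resid L V o ^ 2) * g (obsZ o, U o) ∂(L : Measure (Obs p)) =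
      ∫⁻ o, condVar L V (obsZ o) * g (obsZ o, U o) ∂(L : Measure (Obs p)) := by
  have hZ : Measurable (obsZ (p := p)) := measurable_obsZ
  let F : ((Fin p → ℝ) × ℝ) × ℝ → ℝ≥0∞ := fun q =>
    ENNReal.ofReal ((q.2 - condMean L V q.1.1) ^ 2) * g q.1
  have hF : Measurable F := by fun_prop
  calc _ = ∫⁻ q, F q ∂((L : Measure (Obs p)).map fun o => ((obsZ o, U o), V o)) := by
        rw [lintegral_map hF (by fun_prop)]; rfl
    _ = _ := by
      rw [h.map_eq_compProd hV hU, Measure.lintegral_compProd hF]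
      have : ∀ a : (Fin p → ℝ) × ℝ, ∫⁻ b, F (a, b)
          ∂((condDistrib V obsZ (L : Measure (Obs p))).prodMkRight ℝ a) =
            condVar L V a.1 * g a := fun a => by
        rw [condVar_eq, ← lintegral_mul_const _ (by fun_prop)]
        rfl
      simp_rw [this]
      rw [lintegral_map (by fun_prop) (by fun_prop)]

/-- Integrating `V` out first leaves its centered conditional mean. Integrability of `V` makes
almost every conditional law integrable, so that `condMean` is a genuine mean there and not the
default value 0. -/
theorem CondIndepGivenZ.integral_resid_mul (h : CondIndepGivenZ L V U) (hV : Measurable V)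
    (hU : Measurable U) (hVint : Integrable V (L : Measure (Obs p)))
    {g : (Fin p → ℝ) × ℝ → ℝ} (hg : Measurable g)
    (hint : Integrable (fun o => resid L V o * g (obsZ o, U o)) (L : Measure (Obs p))) :
    ∫ o, resid L V o * g (obsZ o, U o) ∂(L : Measure (Obs p)) = 0 := by
  have hZ : Measurable (obsZ (p := p)) := measurable_obsZ
  let F : ((Fin p → ℝ) × ℝ) × ℝ → ℝ := fun q => (q.2 - condMean L V q.1.1) * g q.1
  have hF : Measurable F := by fun_prop
  have hmap : Measurable fun o : Obs p => ((obsZ o, U o), V o) := by fun_prop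
  have hFint : Integrable F ((L : Measure (Obs p)).map fun o => ((obsZ o, U o), V o)) := by
    rw [integrable_map_measure hF.aestronglyMeasurable hmap.aemeasurable]
    exact hint
  have hcond : ∀ᵐ z ∂((L : Measure (Obs p)).map obsZ),
      Integrable (fun v => v) (condDistrib V obsZ (L : Measure (Obs p)) z) := by
    have : Integrable (fun q : (Fin p → ℝ) × ℝ => q.2)
        ((L : Measure (Obs p)).map fun o => (obsZ o, V o)) := by
      rw [integrable_map_measure (by fun_prop) (by fun_prop)]
      exact hVint
    exact this.condDistrib_ae_map hV.aemeasurable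
  have hcond' : ∀ᵐ a ∂((L : Measure (Obs p)).map fun o => (obsZ o, U o)),
      Integrable (fun v => v) (condDistrib V obsZ (L : Measure (Obs p)) a.1) := by
    have e : (L : Measure (Obs p)).map obsZ =
        ((L : Measure (Obs p)).map fun o => (obsZ o, U o)).map Prod.fst := by
      rw [Measure.map_map measurable_fst (by fun_prop)]; rfl
    rw [e] at hcond
    exact ae_of_ae_map measurable_fst.aemeasurable hcond
  calc _ = ∫ q, F q ∂((L : Measure (Obs p)).map fun o => ((obsZ o, U o), V o)) := by
        rw [integral_map hmap.aemeasurable hF.aestronglyMeasurable]; rfl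
    _ = 0 := by
      rw [h.map_eq_compProd hV hU] at hFint ⊢
      rw [Measure.integral_compProd hFint]
      refine integral_eq_zero_of_ae ?_
      filter_upwards [hcond'] with a ha
      simp only [F, Kernel.prodMkRight_apply]
      rw [integral_mul_const, integral_sub ha (integrable_const _)]
      simp [condMean]

end

/-! ### Sums of residuals weighted by rules that do not see them -/

/-- Replacing one coordinate of a product sample by an independent copy preserves its law. -/
theorem measurePreserving_update {ι Ω : Type*} [Fintype ι] [DecidableEq ι] [MeasurableSpace Ω]
    (P : Measure Ω) [IsProbabilityMeasure P] (i : ι) :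
    MeasurePreserving (fun q : (ι → Ω) × Ω => Function.update q.1 i q.2)
      ((Measure.pi fun _ : ι => P).prod P) (Measure.pi fun _ : ι => P) := by
  have hm : Measurable fun q : (ι → Ω) × Ω => Function.update q.1 i q.2 := by
    refine measurable_pi_lambda _ fun j => ?_
    by_cases hj : j = i
    · subst hj; simpa using measurable_snd
    · simp only [Function.update_of_ne hj]
      exact (measurable_pi_apply j).comp measurable_fst
  refine ⟨hm, (Measure.pi_eq fun s hs => ?_).symm⟩
  rw [Measure.map_apply hm (MeasurableSet.univ_pi hs)]
  have e : (fun q : (ι → Ω) × Ω => Function.update q.1 i q.2) ⁻¹' Set.univ.pi s =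
      (Set.univ.pi (Function.update s i Set.univ)) ×ˢ s i := by
    ext q
    simp only [Set.mem_preimage, Set.mem_pi, Set.mem_univ, true_implies, Set.mem_prod]
    constructor
    · intro hq
      refine ⟨fun j => ?_, by simpa using hq i⟩
      by_cases hj : j = i
      · subst hj; simp
      · simpa [Function.update_of_ne hj] using hq j
    · rintro ⟨h1, h2⟩ j
      by_cases hj : j = i
      · subst hj; simpa using h2
      · simpa [Function.update_of_ne hj] using h1 j
  rw [e, Measure.prod_prod, Measure.pi_pi, ← Finset.mul_prod_erase _ _ (Finset.mem_univ i),
    ← Finset.mul_prod_erase _ (fun j => P (s j)) (Finset.mem_univ i)]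
  simp only [Function.update_self, measure_univ, one_mul]
  rw [mul_comm]
  congr 1
  exact Finset.prod_congr rfl fun j hj => by rw [Function.update_of_ne (Finset.ne_of_mem_erase hj)]

section Sample

variable {p n : ℕ} {L : ProbabilityMeasure (Obs p)} {V U : Obs p → ℝ}

instance : IsProbabilityMeasure (sampleLaw n L) := by unfold sampleLaw; infer_instance

/-- The part of a sample seen by a rule that uses the variable `U` and the covariates. -/
def seen (U : Obs p → ℝ) (d : Data p n) : (Fin n → ℝ) × (Fin n → Fin p → ℝ) :=
  (fun j => U (d j), d.z)

theorem measurable_z : Measurable (Data.z (p := p) (n := n)) :=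
  measurable_pi_lambda _ fun i => measurable_obsZ.comp (measurable_pi_apply i)

theorem measurable_seen (hU : Measurable U) : Measurable (seen (n := n) U) :=
  (measurable_pi_lambda _ fun i => hU.comp (measurable_pi_apply i)).prodMk measurable_z

theorem seen_update (d : Data p n) (i : Fin n) (o : Obs p) :
    seen U (Function.update d i o) =
      (Function.update (seen U d).1 i (U o), Function.update (seen U d).2 i (obsZ o)) := by
  refine Prod.ext (funext fun j => ?_) (funext fun j => ?_) <;>
  · by_cases hj : j = i
    · subst hj; simp [seen, Data.z]
    · simp [seen, Data.z, Function.update_of_ne hj]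

theorem measurable_update_seen (w : (Fin n → ℝ) × (Fin n → Fin p → ℝ)) (i : Fin n) :
    Measurable fun q : (Fin p → ℝ) × ℝ =>
      ((Function.update w.1 i q.2, Function.update w.2 i q.1) :
        (Fin n → ℝ) × (Fin n → Fin p → ℝ)) :=
  ((measurable_update w.1).comp measurable_snd).prodMk
    ((measurable_update w.2).comp measurable_fst)

/-- The weight may use the whole `U` and `Z` sample, including observation `i`. Redrawing
observation `i` with the others frozen makes it a function of `(Zᵢ, Uᵢ)`, which is the
one-observation identity. -/
theorem CondIndepGivenZ.lintegral_sample_resid_sq_mul (h : CondIndepGivenZ L V U)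
    (hV : Measurable V) (hU : Measurable U) (i : Fin n)
    {G : (Fin n → ℝ) × (Fin n → Fin p → ℝ) → ℝ≥0∞} (hG : Measurable G) :
    ∫⁻ d, ENNReal.ofReal (resid L V (d i) ^ 2) * G (seen U d) ∂(sampleLaw n L) =
      ∫⁻ d, condVar L V (d.z i) * G (seen U d) ∂(sampleLaw n L) := by
  have hmp := measurePreserving_update (L : Measure (Obs p)) i
  have hs := measurable_seen (n := n) hU
  have hr := measurable_resid L hV
  have hz : Measurable fun d : Data p n => d.z i := (measurable_pi_apply i).comp measurable_z
  have hm1 : Measurable fun d : Data p n => ENNReal.ofReal (resid L V (d i) ^ 2) * G (seen U d) := by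
    fun_prop
  have hm2 : Measurable fun d : Data p n => condVar L V (d.z i) * G (seen U d) := by
    fun_prop
  have k1 := lintegral_prod (μ := Measure.pi fun _ : Fin n => (L : Measure (Obs p)))
    (ν := (L : Measure (Obs p))) _ (hm1.comp hmp.measurable).aemeasurable
  have k2 := lintegral_prod (μ := Measure.pi fun _ : Fin n => (L : Measure (Obs p)))
    (ν := (L : Measure (Obs p))) _ (hm2.comp hmp.measurable).aemeasurable
  simp only [Function.comp_def] at k1 k2
  rw [sampleLaw, ← hmp.lintegral_comp hm1, ← hmp.lintegral_comp hm2, k1, k2]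
  refine lintegral_congr fun d => ?_
  simp only [seen_update, Data.z, Function.update_self]
  exact h.lintegral_resid_sq_mul hV hU (hG.comp (measurable_update_seen (seen U d) i))

/-- When observation `i` is redrawn, the residual of observation `j ≠ i` is a constant, so it joins
the weight and the residual of `i` integrates to zero. These are the cross terms of the variance
computation. -/
theorem CondIndepGivenZ.integral_sample_resid_mul (h : CondIndepGivenZ L V U)
    (hV : Measurable V) (hU : Measurable U) (hVint : Integrable V (L : Measure (Obs p)))
    {i j : Fin n} (hij : j ≠ i)
    {G : (Fin n → ℝ) × (Fin n → Fin p → ℝ) → ℝ} (hG : Measurable G)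
    (hint : Integrable (fun d => resid L V (d i) * (resid L V (d j) * G (seen U d)))
      (sampleLaw n L)) :
    ∫ d, resid L V (d i) * (resid L V (d j) * G (seen U d)) ∂(sampleLaw n L) = 0 := by
  have hmp := measurePreserving_update (L : Measure (Obs p)) i
  have hint' := hmp.integrable_comp_of_integrable hint
  have e := hmp.map_eq ▸ integral_map hmp.measurable.aemeasurable
    (f := fun d : Data p n => resid L V (d i) * (resid L V (d j) * G (seen U d)))
    (by rw [hmp.map_eq]; exact hint.aestronglyMeasurable)
  simp only [Function.comp_def] at hint'
  rw [sampleLaw, e, integral_prod _ hint']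
  refine integral_eq_zero_of_ae ?_
  filter_upwards [hint'.prod_right_ae] with d hd
  simp only [seen_update, Function.update_self, Function.update_of_ne hij] at hd ⊢
  exact h.integral_resid_mul hV hU hVint
    (g := fun q => resid L V (d j) *
      G (Function.update (seen U d).1 i q.2, Function.update (seen U d).2 i q.1))
    ((hG.comp (measurable_update_seen (seen U d) i)).const_mul _) hd

/-- Cross terms vanish, so the squared sum and the sum of squares have the same expectation, namely
that of the conditional variance, which `hc` bounds pointwise. -/
theorem CondIndepGivenZ.lintegral_sum_resid_le (h : CondIndepGivenZ L V U)
    (hV : Measurable V) (hU : Measurable U) (hVint : Integrable V (L : Measure (Obs p)))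
    {G : Fin n → (Fin n → ℝ) × (Fin n → Fin p → ℝ) → ℝ} (hG : ∀ i, Measurable (G i)) {c : ℝ}
    (hc : ∀ w, ∑ i, condVar L V (w.2 i) * ENNReal.ofReal (G i w ^ 2) ≤ ENNReal.ofReal c) :
    ∫⁻ d, ENNReal.ofReal (∑ i, (resid L V (d i) * G i (seen U d)) ^ 2) ∂(sampleLaw n L) ≤
        ENNReal.ofReal c ∧
      ∫⁻ d, ENNReal.ofReal ((∑ i, resid L V (d i) * G i (seen U d)) ^ 2) ∂(sampleLaw n L) ≤
        ENNReal.ofReal c := by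
  have hs := measurable_seen (n := n) hU
  have hr := measurable_resid L hV
  have hm : ∀ i, Measurable fun d : Data p n => resid L V (d i) * G i (seen U d) := fun i => by
    fun_prop
  have e1 : ∫⁻ d, ENNReal.ofReal (∑ i, (resid L V (d i) * G i (seen U d)) ^ 2) ∂(sampleLaw n L) =
      ∑ i, ∫⁻ d, ENNReal.ofReal ((resid L V (d i) * G i (seen U d)) ^ 2) ∂(sampleLaw n L) := by
    rw [← lintegral_finsetSum _ fun i _ => by fun_prop]
    refine lintegral_congr fun d => ?_
    rw [ENNReal.ofReal_sum_of_nonneg fun i _ => sq_nonneg _]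
  have e2 : ∫⁻ d, ENNReal.ofReal (∑ i, (resid L V (d i) * G i (seen U d)) ^ 2) ∂(sampleLaw n L) ≤
      ENNReal.ofReal c := by
    rw [e1]
    have : ∀ i, ∫⁻ d, ENNReal.ofReal ((resid L V (d i) * G i (seen U d)) ^ 2) ∂(sampleLaw n L) =
        ∫⁻ d, condVar L V (d.z i) * ENNReal.ofReal (G i (seen U d) ^ 2) ∂(sampleLaw n L) :=
      fun i => by
        rw [← h.lintegral_sample_resid_sq_mul hV hU i (G := fun w => ENNReal.ofReal (G i w ^ 2))
          (by fun_prop)]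
        refine lintegral_congr fun d => ?_
        rw [mul_pow, ENNReal.ofReal_mul (sq_nonneg _)]
    have hz : ∀ i, Measurable fun d : Data p n => d.z i := fun i =>
      (measurable_pi_apply i).comp measurable_z
    simp_rw [this]
    rw [← lintegral_finsetSum _ fun i _ => by fun_prop]
    calc _ ≤ ∫⁻ _, ENNReal.ofReal c ∂(sampleLaw n L) := lintegral_mono fun d => hc (seen U d)
      _ = _ := by simp
  refine ⟨e2, ?_⟩
  -- No second moment of `V` is assumed; the bound just proved supplies square integrability of the
  -- weighted residuals, which the cross terms need.
  have hL2 : ∀ i, MemLp (fun d => resid L V (d i) * G i (seen U d)) 2 (sampleLaw n L) := fun i => by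
    rw [memLp_two_iff_integrable_sq (hm i).aestronglyMeasurable]
    refine ⟨((hm i).pow_const 2).aestronglyMeasurable, ?_⟩
    rw [hasFiniteIntegral_iff_ofReal (Eventually.of_forall fun d => sq_nonneg _)]
    rw [e1] at e2
    refine lt_of_le_of_lt ((Finset.single_le_sum (fun _ _ => zero_le) (Finset.mem_univ i)).trans e2)
      ENNReal.ofReal_lt_top
  have hprod : ∀ i j, Integrable (fun d => (resid L V (d i) * G i (seen U d)) *
      (resid L V (d j) * G j (seen U d))) (sampleLaw n L) := fun i j =>
    (hL2 i).integrable_mul (hL2 j)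
  have hzero : ∀ i j, j ≠ i → ∫ d, (resid L V (d i) * G i (seen U d)) *
      (resid L V (d j) * G j (seen U d)) ∂(sampleLaw n L) = 0 := fun i j hij => by
    have e : ∀ d : Data p n, (resid L V (d i) * G i (seen U d)) *
        (resid L V (d j) * G j (seen U d)) =
        resid L V (d i) * (resid L V (d j) * (G i (seen U d) * G j (seen U d))) := fun d => by ring
    have hi := hprod i j
    simp_rw [e] at hi ⊢
    exact h.integral_sample_resid_mul hV hU hVint hij (G := fun w => G i w * G j w)
      ((hG i).mul (hG j)) hi
  have e3 : ∫ d, (∑ i, resid L V (d i) * G i (seen U d)) ^ 2 ∂(sampleLaw n L) =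
      ∫ d, ∑ i, (resid L V (d i) * G i (seen U d)) ^ 2 ∂(sampleLaw n L) := by
    simp_rw [sq, Finset.sum_mul_sum]
    rw [integral_finsetSum _ fun i _ => integrable_finsetSum _ fun j _ => hprod i j,
      integral_finsetSum _ fun i _ => hprod i i]
    refine Finset.sum_congr rfl fun i _ => ?_
    rw [integral_finsetSum _ fun j _ => hprod i j]
    exact Finset.sum_eq_single i (fun j _ hij => hzero i j hij) (by simp)
  have hi1 : Integrable (fun d => (∑ i, resid L V (d i) * G i (seen U d)) ^ 2) (sampleLaw n L) :=
    (memLp_finsetSum _ fun i _ => hL2 i).integrable_sq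
  have hi2 : Integrable (fun d => ∑ i, (resid L V (d i) * G i (seen U d)) ^ 2) (sampleLaw n L) :=
    integrable_finsetSum _ fun i _ => (hL2 i).integrable_sq
  rw [← ofReal_integral_eq_lintegral_ofReal hi1 (Eventually.of_forall fun d => sq_nonneg _), e3,
    ofReal_integral_eq_lintegral_ofReal hi2
      (Eventually.of_forall fun d => Finset.sum_nonneg fun i _ => sq_nonneg _)]
  exact e2

/-- A conditional Chebyshev inequality for sums of residuals weighted by functions of the other
variables. -/
theorem CondIndepGivenZ.measure_sum_resid_gt_le (h : CondIndepGivenZ L V U)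
    (hV : Measurable V) (hU : Measurable U) (hVint : Integrable V (L : Measure (Obs p)))
    {G : Fin n → (Fin n → ℝ) × (Fin n → Fin p → ℝ) → ℝ} (hG : ∀ i, Measurable (G i)) {c κ : ℝ}
    (hκ : 0 < κ) :
    sampleLaw n L {d | κ < ∑ i, (resid L V (d i) * G i (seen U d)) ^ 2} ≤
        sampleLaw n L {d | ENNReal.ofReal c <
          ∑ i, condVar L V (d.z i) * ENNReal.ofReal (G i (seen U d) ^ 2)} + ENNReal.ofReal (c / κ) ∧
      sampleLaw n L {d | κ < (∑ i, resid L V (d i) * G i (seen U d)) ^ 2} ≤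
        sampleLaw n L {d | ENNReal.ofReal c <
          ∑ i, condVar L V (d.z i) * ENNReal.ofReal (G i (seen U d) ^ 2)} +
            ENNReal.ofReal (c / κ) := by
  -- Having small conditional variance is an event in the `U` and `Z` data alone. Its indicator can
  -- therefore be absorbed into the weights, which makes the bound deterministic.
  let A : Set ((Fin n → ℝ) × (Fin n → Fin p → ℝ)) :=
    {w | ∑ i, condVar L V (w.2 i) * ENNReal.ofReal (G i w ^ 2) ≤ ENNReal.ofReal c}
  have hA : MeasurableSet A := measurableSet_le (by fun_prop) measurable_const
  let G' : Fin n → (Fin n → ℝ) × (Fin n → Fin p → ℝ) → ℝ := fun i => A.indicator (G i)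
  have hG' : ∀ i, Measurable (G' i) := fun i => (hG i).indicator hA
  have hc : ∀ w, ∑ i, condVar L V (w.2 i) * ENNReal.ofReal (G' i w ^ 2) ≤ ENNReal.ofReal c := by
    intro w
    by_cases hw : w ∈ A
    · simp only [G', Set.indicator_of_mem hw]; exact hw
    · simp [G', Set.indicator_of_notMem hw]
  obtain ⟨h1, h2⟩ := h.lintegral_sum_resid_le hV hU hVint hG' hc
  have hs := measurable_seen (n := n) hU
  have hr := measurable_resid L hV
  have main : ∀ f : (Fin n → ℝ) → ℝ, Measurable f →
      ∫⁻ d, ENNReal.ofReal (f fun i => resid L V (d i) * G' i (seen U d)) ∂(sampleLaw n L) ≤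
        ENNReal.ofReal c →
      sampleLaw n L {d | κ < f fun i => resid L V (d i) * G i (seen U d)} ≤
        sampleLaw n L {d | ENNReal.ofReal c <
          ∑ i, condVar L V (d.z i) * ENNReal.ofReal (G i (seen U d) ^ 2)} +
            ENNReal.ofReal (c / κ) := by
    intro f hf hle
    have hsub : {d : Data p n | κ < f fun i => resid L V (d i) * G i (seen U d)} ⊆
        {d | ENNReal.ofReal c <
          ∑ i, condVar L V (d.z i) * ENNReal.ofReal (G i (seen U d) ^ 2)} ∪
        {d | ENNReal.ofReal κ ≤
          ENNReal.ofReal (f fun i => resid L V (d i) * G' i (seen U d))} := by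
      intro d hd
      by_cases hw : seen U d ∈ A
      · right
        have hd' : κ < f fun i => resid L V (d i) * G i (seen U d) := hd
        simp only [Set.mem_ofPred_eq, G', Set.indicator_of_mem hw]
        exact ENNReal.ofReal_le_ofReal hd'.le
      · left
        have hw' : ENNReal.ofReal c <
            ∑ i, condVar L V ((seen U d).2 i) * ENNReal.ofReal (G i (seen U d) ^ 2) := by
          simpa [A] using hw
        exact hw'
    refine (measure_mono hsub).trans ((measure_union_le _ _).trans ?_)
    gcongr
    rw [ENNReal.ofReal_div_of_pos hκ]
    refine (meas_ge_le_lintegral_div (by fun_prop) (by simpa using hκ) ENNReal.ofReal_ne_top).trans ?_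
    gcongr
  exact ⟨main (fun x => ∑ i, x i ^ 2) (by fun_prop) h1, main (fun x => (∑ i, x i) ^ 2) (by fun_prop) h2⟩

end Sample

/-! ### Studentized central limit theorem with a remainder -/

theorem pi_map_eq_map_pi {ι : Type*} [Fintype ι] {Ω Ω' : Type*} [MeasurableSpace Ω]
    [MeasurableSpace Ω'] {P : ι → Measure Ω} [∀ i, IsProbabilityMeasure (P i)] {f : ι → Ω → Ω'}
    (hf : ∀ i, Measurable (f i)) :
    Measure.pi (fun i => (P i).map (f i)) = (Measure.pi P).map fun x i => f i (x i) := by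
  have : ∀ i, IsProbabilityMeasure ((P i).map (f i)) := fun i =>
    Measure.isProbabilityMeasure_map (hf i).aemeasurable
  refine Measure.pi_eq fun s hs => ?_
  have hm : Measurable fun (x : ι → Ω) i => f i (x i) :=
    measurable_pi_lambda _ fun i => (hf i).comp (measurable_pi_apply i)
  rw [Measure.map_apply hm (MeasurableSet.univ_pi hs)]
  have e : (fun (x : ι → Ω) i => f i (x i)) ⁻¹' Set.univ.pi s =
      Set.univ.pi fun i => f i ⁻¹' s i := by
    ext x; simp
  rw [e, Measure.pi_pi]
  exact Finset.prod_congr rfl fun i _ => (Measure.map_apply (hf i) (hs i)).symm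

theorem IsLyapunovArray.mono {ι : Type*} [Fintype ι] {δ η η' : ℝ} {μ : ι → Measure ℝ}
    (h : IsLyapunovArray δ η μ) (hη : η ≤ η') : IsLyapunovArray δ η' μ :=
  { h with sum_moment := h.sum_moment.trans hη }

/-- Normalizing independent centered variables by the standard deviation of their sum. -/
theorem isLyapunovArray_map {ι Ω : Type*} [Fintype ι] [MeasurableSpace Ω] {P : ι → Measure Ω}
    [∀ i, IsProbabilityMeasure (P i)] {f : ι → Ω → ℝ} (hf : ∀ i, Measurable (f i)) {δ η S : ℝ}
    (hδ : 0 < δ) (hη : 0 ≤ η) (hS : 0 < S) (h0 : ∀ i, ∫ x, f i x ∂(P i) = 0)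
    (hvar : ∑ i, ∫ x, f i x ^ 2 ∂(P i) = S ^ 2)
    (hmom : ∑ i, ∫⁻ x, ENNReal.ofReal (|f i x| ^ (2 + δ)) ∂(P i) ≤
      ENNReal.ofReal (η * S ^ (2 + δ))) :
    IsLyapunovArray δ η fun i => (P i).map fun x => f i x / S := by
  have hSp : 0 < S ^ (2 + δ) := Real.rpow_pos_of_pos hS _
  have hfS : ∀ i, Measurable fun x => f i x / S := fun i => (hf i).div_const S
  have hpow : ∀ i x, |f i x / S| ^ (2 + δ) = |f i x| ^ (2 + δ) / S ^ (2 + δ) := fun i x => by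
    rw [abs_div, abs_of_pos hS, Real.div_rpow (abs_nonneg _) hS.le]
  have hint : ∀ i, Integrable (fun x => |f i x| ^ (2 + δ)) (P i) := fun i => by
    have := hf i
    refine ⟨by fun_prop (disch := positivity), ?_⟩
    rw [hasFiniteIntegral_iff_ofReal (Eventually.of_forall fun x => by positivity)]
    exact lt_of_le_of_lt ((Finset.single_le_sum (fun _ _ => zero_le) (Finset.mem_univ i)).trans hmom)
      ENNReal.ofReal_lt_top
  refine ⟨fun i => Measure.isProbabilityMeasure_map (hfS i).aemeasurable, fun i => ?_, fun i => ?_,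
    ?_, ?_⟩
  · rw [integral_map (hfS i).aemeasurable (by fun_prop), integral_div, h0 i, zero_div]
  · rw [integrable_map_measure (by fun_prop (disch := positivity)) (hfS i).aemeasurable]
    simp only [Function.comp_def, hpow]
    exact (hint i).div_const _
  · have : ∀ i, ∫ x, x ^ 2 ∂((P i).map fun x => f i x / S) = (∫ x, f i x ^ 2 ∂(P i)) / S ^ 2 :=
      fun i => by
        rw [integral_map (hfS i).aemeasurable (by fun_prop)]
        simp_rw [div_pow]
        rw [integral_div]
    simp_rw [this]
    rw [← Finset.sum_div, hvar, div_self (by positivity)]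
  · have : ∀ i, ∫ x, |x| ^ (2 + δ) ∂((P i).map fun x => f i x / S) =
        (∫ x, |f i x| ^ (2 + δ) ∂(P i)) / S ^ (2 + δ) := fun i => by
      rw [integral_map (hfS i).aemeasurable (by fun_prop (disch := positivity))]
      simp_rw [hpow]
      rw [integral_div]
    simp_rw [this]
    rw [← Finset.sum_div, div_le_iff₀ hSp]
    have e : ∀ i, ∫⁻ x, ENNReal.ofReal (|f i x| ^ (2 + δ)) ∂(P i) =
        ENNReal.ofReal (∫ x, |f i x| ^ (2 + δ) ∂(P i)) := fun i =>
      (ofReal_integral_eq_lintegral_ofReal (hint i)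
        (Eventually.of_forall fun x => by positivity)).symm
    simp_rw [e] at hmom
    rw [← ENNReal.ofReal_sum_of_nonneg fun i _ => integral_nonneg fun x => by positivity] at hmom
    exact (ENNReal.ofReal_le_ofReal_iff (by positivity)).1 hmom

/-- The central limit theorem for studentized sums of independent centered variables with small
Lyapunov ratio, uniformly over such arrays and with an error term for perturbed summands. -/
theorem exists_studentized_clt (t : ℝ) {ρ ε : ℝ} (hρ : 0 < ρ) (hε : 0 < ε) :
    ∃ κ : ℝ, 0 < κ ∧ ∀ δ : ℝ, 0 < δ → ∃ (η : ℝ) (N : ℕ), 0 < η ∧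
      ∀ (n : ℕ) {Ω : Type} [MeasurableSpace Ω] (P : Fin n → Measure Ω)
        [∀ i, IsProbabilityMeasure (P i)] (f : Fin n → Ω → ℝ) (S : ℝ)
        (R : Fin n → (Fin n → Ω) → ℝ), N ≤ n → (∀ i, Measurable (f i)) → 0 < S →
        (∀ i, ∫ x, f i x ∂(P i) = 0) → ∑ i, ∫ x, f i x ^ 2 ∂(P i) = S ^ 2 →
        ∑ i, ∫⁻ x, ENNReal.ofReal (|f i x| ^ (2 + δ)) ∂(P i) ≤
          ENNReal.ofReal (η * S ^ (2 + δ)) →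
        Measure.pi P {x | studentized (fun i => f i (x i) + R i x) ≤ t} ≤
            ENNReal.ofReal ((gaussianReal 0 1).real (Set.Iic (t + ρ)) + ε) +
              Measure.pi P {x | ¬ (∑ i, R i x ^ 2 ≤ κ * S ^ 2 ∧ |∑ i, R i x| ≤ κ * S)} ∧
          Measure.pi P {x | t < studentized fun i => f i (x i) + R i x} ≤
            ENNReal.ofReal (1 - (gaussianReal 0 1).real (Set.Iic (t - ρ)) + ε) +
              Measure.pi P {x | ¬ (∑ i, R i x ^ 2 ≤ κ * S ^ 2 ∧ |∑ i, R i x| ≤ κ * S)} := by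
  obtain ⟨κ, hκ, hpert⟩ := exists_studentized_perturbation t hρ
  refine ⟨κ, hκ, fun δ hδ => ?_⟩
  obtain ⟨η₁, hη₁, hclt₁⟩ := exists_lyapunov_clt hδ (half_pos hε) (t + ρ)
  obtain ⟨η₂, hη₂, hclt₂⟩ := exists_lyapunov_clt hδ (half_pos hε) (t - ρ)
  obtain ⟨η₃, hη₃, hlln⟩ := exists_lyapunov_lln hδ (half_pos hε) hκ
  obtain ⟨N, hN⟩ := exists_nat_ge (2 / (ε / 2 * κ))
  have hη : 0 < min η₁ (min η₂ η₃) := lt_min hη₁ (lt_min hη₂ hη₃)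
  refine ⟨min η₁ (min η₂ η₃), max N 1, hη, ?_⟩
  intro n Ω _ P _ f S R hn hf hS h0 hvar hmom
  have hL := isLyapunovArray_map hf hδ hη.le hS h0 hvar hmom
  have hn1 : 1 ≤ n := (le_max_right N 1).trans hn
  have hn0 : (0 : ℝ) < n := by exact_mod_cast hn1
  have hnN : 2 / (ε / 2 * κ) ≤ n := hN.trans (by exact_mod_cast (le_max_left N 1).trans hn)
  have hfS : ∀ i, Measurable fun x => f i x / S := fun i => (hf i).div_const S
  have hpi := pi_map_eq_map_pi (P := P) hfS
  set μ : Fin n → Measure ℝ := fun i => (P i).map fun x => f i x / S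
  have hμ : ∀ i, IsProbabilityMeasure (μ i) := hL.isProb
  have hm : Measurable fun (x : Fin n → Ω) i => f i (x i) / S :=
    measurable_pi_lambda _ fun i => (hfS i).comp (measurable_pi_apply i)
  have b1 := hclt₁ n μ (hL.mono (min_le_left _ _))
  have b2 := hclt₂ n μ (hL.mono ((min_le_right _ _).trans (min_le_left _ _)))
  have b3 := hlln n μ hnN (hL.mono ((min_le_right _ _).trans (min_le_right _ _)))
  set B := {x : Fin n → Ω | ¬ (∑ i, R i x ^ 2 ≤ κ * S ^ 2 ∧ |∑ i, R i x| ≤ κ * S)}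
  set C := {v : Fin n → ℝ | ¬ (|∑ i, v i ^ 2 - 1| ≤ κ ∧ (∑ i, v i) ^ 2 ≤ κ * n)}
  have hstud : ∀ x : Fin n → Ω, studentized (fun i => f i (x i) + R i x) =
      (∑ i, (f i (x i) / S + R i x / S)) / √(∑ i, (f i (x i) / S + R i x / S) ^ 2 -
        (n : ℝ)⁻¹ * (∑ i, (f i (x i) / S + R i x / S)) ^ 2) := fun x => by
    have hq0 : 0 < √(n : ℝ) := Real.sqrt_pos.mpr hn0
    refine studentized_eq hn1 (s := S / √n) (by positivity) fun i => ?_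
    field_simp
  have hkey : ∀ x : Fin n → Ω, x ∉ B → (fun i => f i (x i) / S) ∉ C →
      (studentized (fun i => f i (x i) + R i x) ≤ t → ∑ i, f i (x i) / S ≤ t + ρ) ∧
      (t < studentized (fun i => f i (x i) + R i x) → t - ρ < ∑ i, f i (x i) / S) := by
    intro x hxB hxC
    have hB : ∑ i, R i x ^ 2 ≤ κ * S ^ 2 ∧ |∑ i, R i x| ≤ κ * S := by
      by_contra hc; exact hxB hc
    have hC : |∑ i, (f i (x i) / S) ^ 2 - 1| ≤ κ ∧ (∑ i, f i (x i) / S) ^ 2 ≤ κ * n := by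
      by_contra hc; exact hxC hc
    rw [hstud x]
    refine hpert n (fun i => f i (x i) / S) (fun i => R i x / S) hn1 hC.1 hC.2 ?_ ?_
    · simp_rw [div_pow]
      rw [← Finset.sum_div, div_le_iff₀ (by positivity)]
      exact hB.1
    · rw [← Finset.sum_div, abs_div, abs_of_pos hS, div_le_iff₀ hS]
      exact hB.2
  -- Only upper bounds on outer measures are used from here on, so neither the remainder `R` nor the
  -- events built from it need be measurable.
  have hpush : ∀ E : Set (Fin n → ℝ), Measure.pi P ((fun (x : Fin n → Ω) i => f i (x i) / S) ⁻¹' E)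
      ≤ Measure.pi μ E := fun E => by
    rw [hpi]
    exact Measure.le_map_apply hm.aemeasurable E
  have hreal : ∀ (E : Set (Fin n → ℝ)) (c : ℝ), (Measure.pi μ).real E ≤ c →
      Measure.pi μ E ≤ ENNReal.ofReal c := fun E c h => by
    rw [← ofReal_measureReal]
    exact ENNReal.ofReal_le_ofReal h
  have hfin : ∀ (E : Set (Fin n → ℝ)) (F : Set (Fin n → Ω)) (c : ℝ), 0 ≤ c →
      (Measure.pi μ).real E ≤ c + ε / 2 →
      F ⊆ ((fun (x : Fin n → Ω) i => f i (x i) / S) ⁻¹' E) ∪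
        ((fun (x : Fin n → Ω) i => f i (x i) / S) ⁻¹' C) ∪ B →
      Measure.pi P F ≤ ENNReal.ofReal (c + ε) + Measure.pi P B := by
    intro E F c hc hE hF
    refine (measure_mono hF).trans ((measure_union_le _ _).trans ?_)
    gcongr
    refine (measure_union_le _ _).trans ?_
    have e : c + ε = (c + ε / 2) + ε / 2 := by ring
    rw [e, ENNReal.ofReal_add (by positivity) (by positivity)]
    exact add_le_add ((hpush E).trans (hreal E _ hE)) ((hpush C).trans (hreal C _ b3))
  have b1' := abs_lt.mp b1
  have b2' := abs_lt.mp b2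
  constructor
  · refine hfin {v | ∑ i, v i ≤ t + ρ} _ _ measureReal_nonneg (by linarith [b1'.2]) fun x hx => ?_
    by_cases hxB : x ∈ B
    · exact Or.inr hxB
    by_cases hxC : (fun i => f i (x i) / S) ∈ C
    · exact Or.inl (Or.inr hxC)
    exact Or.inl (Or.inl ((hkey x hxB hxC).1 hx))
  · have hcompl : (Measure.pi μ).real {v : Fin n → ℝ | t - ρ < ∑ i, v i} =
        1 - (Measure.pi μ).real {v | ∑ i, v i ≤ t - ρ} := by
      have hms : MeasurableSet {v : Fin n → ℝ | ∑ i, v i ≤ t - ρ} :=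
        measurableSet_le (by fun_prop) measurable_const
      rw [← probReal_compl_eq_one_sub hms]
      congr 1
      ext v; simp
    refine hfin {v | t - ρ < ∑ i, v i} _ _ ?_ (by rw [hcompl]; linarith [b2'.1]) fun x hx => ?_
    · exact sub_nonneg.mpr measureReal_le_one
    by_cases hxB : x ∈ B
    · exact Or.inr hxB
    by_cases hxC : (fun i => f i (x i) / S) ∈ C
    · exact Or.inl (Or.inr hxC)
    exact Or.inl (Or.inl ((hkey x hxB hxC).2 hx))

/-! ### Normal quantile and lower bound on the critical value -/

/-- A point just below the `(1 - α)`-quantile of the standard normal law. -/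
theorem exists_gaussian_quantile {α β : ℝ} (hα₀ : 0 < α) (hα₁ : α < 1) (hβ : 0 < β) :
    ∃ t ρ ε : ℝ, 0 < ρ ∧ 0 < ε ∧ (gaussianReal 0 1).real (Set.Iic (t + ρ)) + ε < 1 - α ∧
      1 - (gaussianReal 0 1).real (Set.Iic (t - ρ)) + ε ≤ α + β := by
  have hns : NullSingletonClass (gaussianReal 0 1) := nullSingletonClass_gaussianReal one_ne_zero
  have hcont : Continuous (cdf (gaussianReal 0 1)) := by
    refine continuous_iff_continuousAt.2 fun x => ?_
    rw [(monotone_cdf _).continuousAt_iff_leftLim_eq_rightLim, StieltjesFunction.rightLim_eq]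
    have h1 := (cdf (gaussianReal 0 1)).measure_singleton x
    rw [measure_cdf, measure_singleton] at h1
    have h2 := ENNReal.ofReal_eq_zero.1 h1.symm
    exact le_antisymm ((monotone_cdf _).leftLim_le le_rfl) (by linarith)
  -- The normal distribution function equals `1 - α - γ` at `t` and varies by less than `γ / 2`
  -- within `ρ`. Adding `ε = γ / 4` stays below `1 - α` on one side and costs at most `7γ / 4 ≤ β`
  -- on the other.
  set γ := min (β / 2) ((1 - α) / 2)
  have hγ0 : 0 < γ := lt_min (by linarith) (by linarith)
  have hγβ : γ ≤ β / 2 := min_le_left _ _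
  have hγα : γ ≤ (1 - α) / 2 := min_le_right _ _
  obtain ⟨t, ht⟩ : 1 - α - γ ∈ Set.range (cdf (gaussianReal 0 1)) := by
    refine mem_range_of_exists_le_of_exists_ge hcont ?_ ?_
    · exact ((tendsto_cdf_atBot _).eventually_le_const (by linarith)).exists
    · exact ((tendsto_cdf_atTop _).eventually_const_le (by linarith)).exists
  obtain ⟨r, hr, hr'⟩ := Metric.continuousAt_iff.1 (hcont.continuousAt (x := t)) (γ / 2) (half_pos hγ0)
  have d1 : |cdf (gaussianReal 0 1) (t + r / 2) - cdf (gaussianReal 0 1) t| < γ / 2 := by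
    refine hr' ?_
    rw [Real.dist_eq, add_sub_cancel_left, abs_of_pos (by positivity)]; linarith
  have d2 : |cdf (gaussianReal 0 1) (t - r / 2) - cdf (gaussianReal 0 1) t| < γ / 2 := by
    refine hr' ?_
    rw [Real.dist_eq, sub_sub_cancel_left, abs_neg, abs_of_pos (by positivity)]; linarith
  rw [ht] at d1 d2
  refine ⟨t, r / 2, γ / 4, by positivity, by positivity, ?_, ?_⟩
  · rw [← cdf_eq_real]; linarith [(abs_lt.mp d1).2]
  · rw [← cdf_eq_real]; linarith [(abs_lt.mp d2).1]

/-- By monotonicity no level below `t` reaches mass `1 - α`. The set of levels must also be shown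
nonempty, because the infimum of the empty set of reals is 0; this uses `α > 0` and continuity from
below. -/
theorem Learner.le_ndcrtCrit {p n : ℕ} (A : Learner p n) (d : Data p n) {α t : ℝ} (hα₀ : 0 < α)
    (h : (A.resampleLaw d).real {x' | A.ndcrtStat d x' ≤ t} < 1 - α) : t ≤ A.ndcrtCrit d α := by
  have hprob : IsProbabilityMeasure (A.resampleLaw d) := by
    unfold Learner.resampleLaw; infer_instance
  refine le_csInf ?_ fun s hs => ?_
  · have hmono : Monotone fun k : ℕ => {x' | A.ndcrtStat d x' ≤ (k : ℝ)} := fun k l hkl x' hx' =>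
      show A.ndcrtStat d x' ≤ (l : ℝ) from
        le_trans (show A.ndcrtStat d x' ≤ (k : ℝ) from hx') (by exact_mod_cast hkl)
    have hlim := tendsto_measure_iUnion_atTop (μ := A.resampleLaw d) hmono
    have hU : (⋃ k : ℕ, {x' | A.ndcrtStat d x' ≤ (k : ℝ)}) = Set.univ :=
      Set.eq_univ_of_forall fun x' => Set.mem_iUnion.2 (exists_nat_ge (A.ndcrtStat d x'))
    rw [hU, measure_univ] at hlim
    have hlim' := (ENNReal.tendsto_toReal ENNReal.one_ne_top).comp hlim
    obtain ⟨k, hk⟩ := (hlim'.eventually_const_le (show 1 - α < (1 : ℝ≥0∞).toReal by simp; linarith)).exists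
    exact ⟨k, hk⟩
  · by_contra! hst
    have : (A.resampleLaw d).real {x' | A.ndcrtStat d x' ≤ s} ≤
        (A.resampleLaw d).real {x' | A.ndcrtStat d x' ≤ t} :=
      measureReal_mono fun x' hx' => le_trans hx' hst.le
    have hs' : 1 - α ≤ (A.resampleLaw d).real {x' | A.ndcrtStat d x' ≤ s} := hs
    linarith

theorem ofReal_le_inv_mul_rpow_half {n : ℕ} (hn : 1 ≤ n) {g : ℝ} (hg : 0 ≤ g) {T : ℝ≥0∞}
    (h : ENNReal.ofReal (n * g ^ 2) ≤ T) :
    ENNReal.ofReal g ≤ ((n : ℝ≥0∞)⁻¹ * T) ^ (1 / 2 : ℝ) := by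
  have hn0 : (n : ℝ≥0∞) ≠ 0 := by exact_mod_cast (by omega : n ≠ 0)
  have e : ENNReal.ofReal g = (ENNReal.ofReal (g ^ 2)) ^ (1 / 2 : ℝ) := by
    rw [ENNReal.ofReal_rpow_of_nonneg (sq_nonneg g) (by norm_num), ← Real.sqrt_eq_rpow,
      Real.sqrt_sq hg]
  rw [e]
  refine ENNReal.rpow_le_rpow ?_ (by norm_num)
  calc ENNReal.ofReal (g ^ 2) = (n : ℝ≥0∞)⁻¹ * (n * ENNReal.ofReal (g ^ 2)) := by
        rw [← mul_assoc, ENNReal.inv_mul_cancel hn0 (ENNReal.natCast_ne_top n), one_mul]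
    _ ≤ _ := by
      gcongr
      rwa [ENNReal.ofReal_mul (Nat.cast_nonneg n), ENNReal.ofReal_natCast] at h

theorem sq_rpow_half_add {S δ : ℝ} (hS : 0 ≤ S) : (S ^ 2) ^ (1 + δ / 2) = S ^ (2 + δ) := by
  rw [← Real.rpow_natCast S 2, ← Real.rpow_mul hS]
  congr 1; push_cast; ring

/-! ### The resampled statistic, and the remainder of the observed one -/

namespace Learner

variable {p n : ℕ} (A : Learner p n)

theorem measurable_x : Measurable (Data.x (p := p) (n := n)) :=
  measurable_pi_lambda _ fun i => measurable_obsX.comp (measurable_pi_apply i)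

theorem measurable_y : Measurable (Data.y (p := p) (n := n)) :=
  measurable_pi_lambda _ fun i => measurable_obsY.comp (measurable_pi_apply i)

theorem measurable_fitY (i : Fin n) : Measurable fun d => A.fitY d i :=
  A.measurable_muHatY.comp
    ((measurable_y.prodMk measurable_z).prodMk ((measurable_pi_apply i).comp measurable_z))

theorem measurable_fittedVar (i : Fin n) : Measurable fun d => A.fittedVar d i := by
  have := A.isMarkovKernel_lawHat
  exact (measurable_evariance_kernel A.lawHat).comp
    ((measurable_x.prodMk measurable_z).prodMk ((measurable_pi_apply i).comp measurable_z))

theorem measurable_dcrtVar : Measurable A.dcrtVar := by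
  have h1 := A.measurable_fitY
  have h2 := A.measurable_fittedVar
  have h3 : ∀ i, Measurable fun d : Data p n => d.y i := fun i =>
    (measurable_pi_apply i).comp measurable_y
  unfold dcrtVar
  fun_prop

/-- The normalized statistic of the resampled predictors satisfies the central limit theorem, when
its variance is bounded below and its Lyapunov ratio is small. -/
theorem exists_resample_lt (t : ℝ) {ρ ε e₀ δ α : ℝ} (hρ : 0 < ρ) (hε : 0 < ε) (he₀ : 0 < e₀)
    (hδ : 0 < δ) (hα₀ : 0 < α)
    (ht : (gaussianReal 0 1).real (Set.Iic (t + ρ)) + ε < 1 - α) :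
    ∃ (l : ℝ) (N : ℕ), 0 < l ∧ ∀ (n p : ℕ) (A : Learner p n) (d : Data p n), N ≤ n →
      (∀ i, A.fittedVar d i < ∞) → ENNReal.ofReal e₀ ≤ A.dcrtVar d →
      A.lyapunov d δ ≤ ENNReal.ofReal l → t ≤ A.ndcrtCrit d α := by
  obtain ⟨κ, hκ, hclt⟩ := exists_studentized_clt t hρ hε
  obtain ⟨η, N, hη, hclt⟩ := hclt δ hδ
  -- The total variance is at least `n * e₀`, and its power `1 + δ / 2` normalizes the moments; the
  -- power of `n` is already in `lyapunov`, which leaves the power of `e₀`.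
  refine ⟨η * e₀ ^ (1 + δ / 2), max N 1, by positivity, ?_⟩
  intro n p A d hn hfin hvar hlyap
  have hn1 : 1 ≤ n := (le_max_right N 1).trans hn
  have hn0 : (0 : ℝ) < n := by exact_mod_cast hn1
  have hnE : (n : ℝ≥0∞) ≠ 0 := by exact_mod_cast (by omega : n ≠ 0)
  -- Finite fitted variance makes `fitX` a genuine mean, so the resampled residuals are exactly
  -- centered and there is no remainder.
  have hL2 : ∀ i, MemLp id 2 (A.fittedLaw d i) := fun i =>
    (evariance_lt_top_iff_memLp aestronglyMeasurable_id).1 (hfin i)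
  set r : Fin n → ℝ := fun i => d.y i - A.fitY d i
  let f : Fin n → ℝ → ℝ := fun i x => (x - A.fitX d i) * r i
  have hf : ∀ i, Measurable (f i) := fun i => by fun_prop
  have hvi : ∀ i, ∫ x, f i x ^ 2 ∂(A.fittedLaw d i) = Var[id; A.fittedLaw d i] * r i ^ 2 :=
    fun i => by
      simp only [f, mul_pow]
      rw [integral_mul_const, variance_eq_integral aemeasurable_id]
      rfl
  set T : ℝ := ∑ i, ∫ x, f i x ^ 2 ∂(A.fittedLaw d i) with hT
  have hTE : A.dcrtVar d = (n : ℝ≥0∞)⁻¹ * ENNReal.ofReal T := by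
    rw [dcrtVar, hT, ENNReal.ofReal_sum_of_nonneg fun i _ => integral_nonneg fun x => sq_nonneg _]
    congr 1
    refine Finset.sum_congr rfl fun i _ => ?_
    rw [hvi, ENNReal.ofReal_mul (variance_nonneg _ _), (hL2 i).ofReal_variance_eq]
    rfl
  have hTe : n * e₀ ≤ T := by
    have h1 : ENNReal.ofReal (n * e₀) ≤ ENNReal.ofReal T := by
      rw [ENNReal.ofReal_mul hn0.le, ENNReal.ofReal_natCast]
      calc (n : ℝ≥0∞) * ENNReal.ofReal e₀ ≤ n * A.dcrtVar d := by gcongr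
        _ = _ := by
          rw [hTE, ← mul_assoc, ENNReal.mul_inv_cancel hnE (ENNReal.natCast_ne_top n), one_mul]
    by_contra! hc
    exact absurd h1 (not_le.mpr ((ENNReal.ofReal_lt_ofReal_iff (by positivity)).2 hc))
  have hT0 : 0 < T := lt_of_lt_of_le (by positivity) hTe
  have hS0 : 0 < √T := Real.sqrt_pos.mpr hT0
  have hmean : ∀ i, ∫ x, f i x ∂(A.fittedLaw d i) = 0 := fun i => by
    have hi : Integrable (fun x : ℝ => x) (A.fittedLaw d i) := (hL2 i).integrable one_le_two
    simp only [f]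
    rw [integral_mul_const, integral_sub hi (integrable_const _)]
    simp [fitX]
  have hmom : ∑ i, ∫⁻ x, ENNReal.ofReal (|f i x| ^ (2 + δ)) ∂(A.fittedLaw d i) ≤
      ENNReal.ofReal (η * √T ^ (2 + δ)) := by
    have e : ∀ i, ∫⁻ x, ENNReal.ofReal (|f i x| ^ (2 + δ)) ∂(A.fittedLaw d i) =
        ENNReal.ofReal (|r i| ^ (2 + δ)) *
          ∫⁻ x, ENNReal.ofReal (|x - A.fitX d i| ^ (2 + δ)) ∂(A.fittedLaw d i) := fun i => by
      rw [← lintegral_const_mul _ (by fun_prop (disch := positivity))]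
      refine lintegral_congr fun x => ?_
      rw [abs_mul, Real.mul_rpow (abs_nonneg _) (abs_nonneg _), mul_comm,
        ENNReal.ofReal_mul (by positivity)]
    simp_rw [e]
    have hnp : 0 < (n : ℝ) ^ (1 + δ / 2) := Real.rpow_pos_of_pos hn0 _
    calc _ = ENNReal.ofReal ((n : ℝ) ^ (1 + δ / 2)) * A.lyapunov d δ := by
          rw [lyapunov, ← mul_assoc, ← ENNReal.ofReal_mul hnp.le, mul_inv_cancel₀ hnp.ne',
            ENNReal.ofReal_one, one_mul]
      _ ≤ ENNReal.ofReal ((n : ℝ) ^ (1 + δ / 2)) * ENNReal.ofReal (η * e₀ ^ (1 + δ / 2)) := by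
          gcongr
      _ = ENNReal.ofReal (η * (n * e₀) ^ (1 + δ / 2)) := by
          rw [← ENNReal.ofReal_mul hnp.le, Real.mul_rpow hn0.le he₀.le]
          congr 1; ring
      _ ≤ _ := by
          rw [← sq_rpow_half_add hS0.le, Real.sq_sqrt hT0.le]
          refine ENNReal.ofReal_le_ofReal ?_
          gcongr
  obtain ⟨h1, -⟩ := hclt n (fun i => A.fittedLaw d i) f (√T) (fun _ _ => 0)
    ((le_max_left N 1).trans hn) hf hS0 hmean (by rw [Real.sq_sqrt hT0.le]) hmom
  refine A.le_ndcrtCrit d hα₀ ?_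
  have hempty : {x : Fin n → ℝ | ¬ (∑ i : Fin n, (0 : ℝ) ^ 2 ≤ κ * √T ^ 2 ∧
      |∑ i : Fin n, (0 : ℝ)| ≤ κ * √T)} = ∅ := by
    refine Set.eq_empty_of_forall_notMem fun x hx => hx ⟨?_, ?_⟩
    · simp; positivity
    · simp; positivity
  rw [hempty, measure_empty, add_zero] at h1
  refine lt_of_le_of_lt (ENNReal.toReal_le_of_le_ofReal ?_ ?_) ht
  · have : 0 ≤ (gaussianReal 0 1).real (Set.Iic (t + ρ)) := measureReal_nonneg
    linarith
  · refine le_trans (le_of_eq ?_) h1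
    simp only [add_zero]
    rfl

variable (L : ProbabilityMeasure (Obs p))

/-- The part of the `i`-th product of residuals that is due to the errors of the two fits. -/
def remainder (d : Data p n) (i : Fin n) : ℝ :=
  A.residProd d d.x i - resid L obsX (d i) * resid L obsY (d i)

/-- The remainder is `ξb + ζa + ab`. The first two terms are weighted sums of residuals of one
variable, with weights learned from the other variable and `Z`; the last is bounded by
Cauchy–Schwarz. The constant 9 is 3 from `(x + y + z)² ≤ 3 (x² + y² + z²)` times three terms, each
at most `β n`. -/
theorem measure_remainder_le (hn : 1 ≤ n) {L : ProbabilityMeasure (Obs p)} (hL : L ∈ nullLaws p)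
    (hX : Integrable obsX (L : Measure (Obs p))) (hY : Integrable obsY (L : Measure (Obs p)))
    {β g : ℝ} (hβ : 0 < β) (hg : 0 < g) :
    sampleLaw n L {d | ¬ (∑ i, A.remainder L d i ^ 2 ≤ 9 * β * n ∧
        (∑ i, A.remainder L d i) ^ 2 ≤ 9 * β * n)} ≤
      sampleLaw n L {d | ENNReal.ofReal √β ≤
          (n : ℝ≥0∞) ^ (1 / 2 : ℝ) * (A.errX d L * A.errY d L)} +
        2 * (sampleLaw n L {d | ENNReal.ofReal g ≤ A.errX' d L} + ENNReal.ofReal (g ^ 2 / β)) +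
        2 * (sampleLaw n L {d | ENNReal.ofReal g ≤ A.errY' d L} + ENNReal.ofReal (g ^ 2 / β)) := by
  have hn0 : (0 : ℝ) < n := by exact_mod_cast hn
  have hnE : (n : ℝ≥0∞) ≠ 0 := by exact_mod_cast (by omega : n ≠ 0)
  have hXY : CondIndepGivenZ L obsX obsY := hL
  have hYX : CondIndepGivenZ L obsY obsX := hXY.symm
  have := A.isMarkovKernel_lawHat
  let Ga : Fin n → (Fin n → ℝ) × (Fin n → Fin p → ℝ) → ℝ := fun i w =>
    condMean L obsX (w.2 i) - ∫ x, x ∂(A.lawHat (w, w.2 i))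
  let Gb : Fin n → (Fin n → ℝ) × (Fin n → Fin p → ℝ) → ℝ := fun i w =>
    condMean L obsY (w.2 i) - A.muHatY (w, w.2 i)
  have hm := measurable_integral_kernel A.lawHat
  have hmY := A.measurable_muHatY
  have hwi : ∀ i : Fin n, Measurable fun w : (Fin n → ℝ) × (Fin n → Fin p → ℝ) => w.2 i :=
    fun i => (measurable_pi_apply i).comp measurable_snd
  have hGa : ∀ i, Measurable (Ga i) := fun i =>
    ((measurable_condMean L obsX).comp (hwi i)).sub (hm.comp (measurable_id.prodMk (hwi i)))
  have hGb : ∀ i, Measurable (Gb i) := fun i =>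
    ((measurable_condMean L obsY).comp (hwi i)).sub (hmY.comp (measurable_id.prodMk (hwi i)))
  set a : Fin n → Data p n → ℝ := fun i d => Ga i (seen obsX d) with ha
  set b : Fin n → Data p n → ℝ := fun i d => Gb i (seen obsY d) with hb
  have ha' : ∀ d i, (A.fitX d i - condMean L obsX (d.z i)) ^ 2 = a i d ^ 2 := fun d i =>
    sub_sq_comm _ _
  have hb' : ∀ d i, (A.fitY d i - condMean L obsY (d.z i)) ^ 2 = b i d ^ 2 := fun d i =>
    sub_sq_comm _ _
  -- The level `n g²` for the conditional variance corresponds to `errY' = g`, and against the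
  -- threshold `β n` it leaves the Chebyshev term `g² / β`.
  obtain ⟨x1, x2⟩ := hXY.measure_sum_resid_gt_le measurable_obsX measurable_obsY hX hGb
    (c := n * g ^ 2) (show 0 < β * n by positivity)
  obtain ⟨y1, y2⟩ := hYX.measure_sum_resid_gt_le measurable_obsY measurable_obsX hY hGa
    (c := n * g ^ 2) (show 0 < β * n by positivity)
  have ec : n * g ^ 2 / (β * n) = g ^ 2 / β := by field_simp
  rw [ec] at x1 x2 y1 y2
  have hYsub : sampleLaw n L {d | ENNReal.ofReal (n * g ^ 2) <
      ∑ i, condVar L obsX (d.z i) * ENNReal.ofReal (b i d ^ 2)} ≤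
      sampleLaw n L {d | ENNReal.ofReal g ≤ A.errY' d L} := by
    refine measure_mono fun d hd => ?_
    have := ofReal_le_inv_mul_rpow_half hn hg.le (le_of_lt hd)
    refine this.trans (le_of_eq ?_)
    unfold errY'
    simp_rw [hb', mul_comm]
  have hXsub : sampleLaw n L {d | ENNReal.ofReal (n * g ^ 2) <
      ∑ i, condVar L obsY (d.z i) * ENNReal.ofReal (a i d ^ 2)} ≤
      sampleLaw n L {d | ENNReal.ofReal g ≤ A.errX' d L} := by
    refine measure_mono fun d hd => ?_
    have := ofReal_le_inv_mul_rpow_half hn hg.le (le_of_lt hd)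
    refine this.trans (le_of_eq ?_)
    unfold errX'
    simp_rw [ha', mul_comm]
  have hABsub : sampleLaw n L {d | β * n < (∑ i, a i d ^ 2) * ∑ i, b i d ^ 2} ≤
      sampleLaw n L {d | ENNReal.ofReal √β ≤
          (n : ℝ≥0∞) ^ (1 / 2 : ℝ) * (A.errX d L * A.errY d L)} := by
    refine measure_mono fun d hd => ?_
    have hd' : β * n < (∑ i, a i d ^ 2) * ∑ i, b i d ^ 2 := hd
    have h1 : ENNReal.ofReal (n * √β ^ 2) ≤
        (∑ i, ENNReal.ofReal (a i d ^ 2)) * ∑ i, ENNReal.ofReal (b i d ^ 2) := by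
      rw [← ENNReal.ofReal_sum_of_nonneg fun i _ => sq_nonneg _,
        ← ENNReal.ofReal_sum_of_nonneg fun i _ => sq_nonneg _,
        ← ENNReal.ofReal_mul (Finset.sum_nonneg fun i _ => sq_nonneg _), Real.sq_sqrt hβ.le]
      exact ENNReal.ofReal_le_ofReal (by linarith)
    refine (ofReal_le_inv_mul_rpow_half hn (Real.sqrt_nonneg β) h1).trans (le_of_eq ?_)
    unfold errX errY
    simp_rw [ha', hb']
    rw [← ENNReal.mul_rpow_of_nonneg _ _ (by norm_num), ← ENNReal.mul_rpow_of_nonneg _ _ (by norm_num)]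
    congr 1
    have hassoc : ∀ u v : ℝ≥0∞, (n : ℝ≥0∞) * ((n : ℝ≥0∞)⁻¹ * u * ((n : ℝ≥0∞)⁻¹ * v)) =
        (n * (n : ℝ≥0∞)⁻¹) * ((n : ℝ≥0∞)⁻¹ * (u * v)) := fun u v => by ring
    rw [hassoc, ENNReal.mul_inv_cancel hnE (ENNReal.natCast_ne_top n), one_mul]
  have hsub : {d | ¬ (∑ i, A.remainder L d i ^ 2 ≤ 9 * β * n ∧
        (∑ i, A.remainder L d i) ^ 2 ≤ 9 * β * n)} ⊆
      {d | β * n < (∑ i, a i d ^ 2) * ∑ i, b i d ^ 2} ∪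
        ({d | β * n < ∑ i, (resid L obsY (d i) * a i d) ^ 2} ∪
          {d | β * n < (∑ i, resid L obsY (d i) * a i d) ^ 2}) ∪
        ({d | β * n < ∑ i, (resid L obsX (d i) * b i d) ^ 2} ∪
          {d | β * n < (∑ i, resid L obsX (d i) * b i d) ^ 2}) := by
    intro d hd
    by_contra hc
    simp only [Set.mem_union, Set.mem_ofPred_eq, not_or, not_lt] at hc
    obtain ⟨⟨c0, c1, c2⟩, c3, c4⟩ := hc
    have hR : ∀ i, A.remainder L d i = resid L obsX (d i) * b i d + resid L obsY (d i) * a i d +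
        a i d * b i d := fun i => by
      have hai : a i d = condMean L obsX (d.z i) - A.fitX d i := rfl
      have hbi : b i d = condMean L obsY (d.z i) - A.fitY d i := rfl
      have hri : A.remainder L d i = (d.x i - A.fitX d i) * (d.y i - A.fitY d i) -
        (d.x i - condMean L obsX (d.z i)) * (d.y i - condMean L obsY (d.z i)) := rfl
      have hxi : resid L obsX (d i) = d.x i - condMean L obsX (d.z i) := rfl
      have hyi : resid L obsY (d i) = d.y i - condMean L obsY (d.z i) := rfl
      rw [hri, hxi, hyi, hai, hbi]
      ring
    have c5 : (∑ i, a i d * b i d) ^ 2 ≤ β * n :=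
      (Finset.sum_mul_sq_le_sq_mul_sq _ _ _).trans c0
    have c6 : ∑ i, (a i d * b i d) ^ 2 ≤ β * n := by
      refine le_trans ?_ c0
      simp_rw [mul_pow]
      rw [Finset.sum_mul]
      refine Finset.sum_le_sum fun i _ => ?_
      exact mul_le_mul_of_nonneg_left
        (Finset.single_le_sum (f := fun i => b i d ^ 2) (fun i _ => sq_nonneg _) (Finset.mem_univ i))
        (sq_nonneg _)
    have h3 : ∀ x y z : ℝ, (x + y + z) ^ 2 ≤ 3 * (x ^ 2 + y ^ 2 + z ^ 2) := fun x y z => by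
      nlinarith only [sq_nonneg (x - y), sq_nonneg (y - z), sq_nonneg (x - z)]
    refine hd ⟨?_, ?_⟩
    · calc ∑ i, A.remainder L d i ^ 2 ≤ ∑ i, 3 * ((resid L obsX (d i) * b i d) ^ 2 +
            (resid L obsY (d i) * a i d) ^ 2 + (a i d * b i d) ^ 2) :=
            Finset.sum_le_sum fun i _ => by rw [hR]; exact h3 _ _ _
        _ = 3 * (∑ i, (resid L obsX (d i) * b i d) ^ 2 + ∑ i, (resid L obsY (d i) * a i d) ^ 2 +
            ∑ i, (a i d * b i d) ^ 2) := by
            rw [← Finset.mul_sum, Finset.sum_add_distrib, Finset.sum_add_distrib]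
        _ ≤ _ := by linarith
    · simp_rw [hR]
      rw [Finset.sum_add_distrib, Finset.sum_add_distrib]
      refine (h3 _ _ _).trans ?_
      linarith
  refine (measure_mono hsub).trans ?_
  refine (measure_union_le _ _).trans (add_le_add ((measure_union_le _ _).trans
    (add_le_add hABsub ((measure_union_le _ _).trans ?_))) ((measure_union_le _ _).trans ?_))
  · rw [two_mul]
    exact add_le_add (y1.trans (add_le_add_left hXsub _)) (y2.trans (add_le_add_left hXsub _))
  · rw [two_mul]
    exact add_le_add (x1.trans (add_le_add_left hYsub _)) (x2.trans (add_le_add_left hYsub _))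

end Learner

/-! ### Asymptotic level along one sequence of laws -/

/-- The statistic of the sample itself satisfies the central limit theorem under the null, up to the
effect of the errors of the two fits. -/
theorem exists_sample_stat_gt_le (t : ℝ) {ρ ε c₁ c₂ δ : ℝ} (hρ : 0 < ρ) (hε : 0 < ε) (hc₁ : 0 < c₁)
    (hδ : 0 < δ) :
    ∃ (b : ℝ) (N : ℕ), 0 < b ∧ ∀ (n p : ℕ) (A : Learner p n) (L : ProbabilityMeasure (Obs p)),
      N ≤ n → L ∈ nullLaws p → Integrable obsX (L : Measure (Obs p)) →
      ENNReal.ofReal c₁ < ∫⁻ o, ENNReal.ofReal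
        ((resid L obsX o) ^ 2 * (resid L obsY o) ^ 2) ∂(L : Measure (Obs p)) →
      ∫⁻ o, ENNReal.ofReal (|resid L obsX o * resid L obsY o| ^ (2 + δ))
        ∂(L : Measure (Obs p)) < ENNReal.ofReal c₂ →
      sampleLaw n L {d | t < A.ndcrtStat d d.x} ≤
        ENNReal.ofReal (1 - (gaussianReal 0 1).real (Set.Iic (t - ρ)) + ε) +
          sampleLaw n L {d | ¬ (∑ i, A.remainder L d i ^ 2 ≤ 9 * b * n ∧
            (∑ i, A.remainder L d i) ^ 2 ≤ 9 * b * n)} := by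
  obtain ⟨κ, hκ, hclt⟩ := exists_studentized_clt t hρ hε
  obtain ⟨η, N, hη, hclt⟩ := hclt δ hδ
  -- For i.i.d. products the Lyapunov ratio is at most `n c₂ / (n c₁) ^ (1 + δ / 2)`, of order `n ^
  -- (-δ / 2)`, hence below `η` from some `M` on.
  obtain ⟨M, hM⟩ := ((tendsto_rpow_atTop (half_pos hδ)).comp
    tendsto_natCast_atTop_atTop).eventually_ge_atTop (c₂ / (η * c₁ ^ (1 + δ / 2))) |>.exists_forall_of_atTop
  -- Since `S² ≥ n c₁`, this choice gives both `9 b n ≤ κ S²` for the squares and `9 b n ≤ (κ S)²`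
  -- for the sum.
  refine ⟨min (κ * c₁) (κ ^ 2 * c₁) / 9, max (max N M) 1, by positivity, ?_⟩
  intro n p A L hn hL hX hlow hupp
  have hn1 : 1 ≤ n := (le_max_right _ 1).trans hn
  have hnN : N ≤ n := ((le_max_left N M).trans (le_max_left _ 1)).trans hn
  have hnM : M ≤ n := ((le_max_right N M).trans (le_max_left _ 1)).trans hn
  have hn0 : (0 : ℝ) < n := by exact_mod_cast hn1
  have hXY : CondIndepGivenZ L obsX obsY := hL
  let f : Fin n → Obs p → ℝ := fun _ o => resid L obsX o * resid L obsY o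
  have hfm : Measurable fun o => resid L obsX o * resid L obsY o :=
    (measurable_resid L measurable_obsX).mul (measurable_resid L measurable_obsY)
  have hpint : Integrable (fun o => |resid L obsX o * resid L obsY o| ^ (2 + δ))
      (L : Measure (Obs p)) := by
    refine ⟨(hfm.abs.pow_const _).aestronglyMeasurable, ?_⟩
    rw [hasFiniteIntegral_iff_ofReal (Eventually.of_forall fun x => by positivity)]
    exact hupp.trans ENNReal.ofReal_lt_top
  have hsq : Integrable (fun o => (resid L obsX o * resid L obsY o) ^ 2) (L : Measure (Obs p)) := by
    refine ((integrable_const (1 : ℝ)).add hpint).mono'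
      (hfm.pow_const 2).aestronglyMeasurable (Eventually.of_forall fun o => ?_)
    rw [Real.norm_eq_abs, abs_of_nonneg (sq_nonneg _)]
    simpa using sq_le_add_rpow one_pos hδ (resid L obsX o * resid L obsY o)
  have h1int : Integrable (fun o => resid L obsX o * resid L obsY o) (L : Measure (Obs p)) :=
    ((memLp_two_iff_integrable_sq hfm.aestronglyMeasurable).2 hsq).integrable one_le_two
  have hmean : ∫ o, resid L obsX o * resid L obsY o ∂(L : Measure (Obs p)) = 0 :=
    hXY.integral_resid_mul measurable_obsX measurable_obsY hX
      (g := fun q => q.2 - condMean L obsY q.1) (by fun_prop) h1int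
  set s := ∫ o, (resid L obsX o * resid L obsY o) ^ 2 ∂(L : Measure (Obs p)) with hs
  have hs1 : c₁ < s := by
    simp_rw [← mul_pow] at hlow
    rw [← ofReal_integral_eq_lintegral_ofReal hsq (Eventually.of_forall fun o => sq_nonneg _)] at hlow
    exact (ENNReal.ofReal_lt_ofReal_iff_of_nonneg hc₁.le).1 hlow
  have hs0 : 0 < s := hc₁.trans hs1
  have hT0 : 0 < n * s := by positivity
  have hS0 : 0 < √(n * s) := Real.sqrt_pos.mpr hT0
  have hS2 : √(n * s) ^ 2 = n * s := Real.sq_sqrt hT0.le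
  have hmom : ∑ i, ∫⁻ o, ENNReal.ofReal (|f i o| ^ (2 + δ)) ∂(L : Measure (Obs p)) ≤
      ENNReal.ofReal (η * √(n * s) ^ (2 + δ)) := by
    have hcp : 0 < c₁ ^ (1 + δ / 2) := Real.rpow_pos_of_pos hc₁ _
    have hM' : c₂ ≤ η * ((n : ℝ) ^ (δ / 2) * c₁ ^ (1 + δ / 2)) := by
      have := hM n hnM
      simp only [Function.comp_apply] at this
      rw [div_le_iff₀ (by positivity)] at this
      linarith
    simp only [f, Finset.sum_const, Finset.card_univ, Fintype.card_fin, nsmul_eq_mul]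
    calc _ ≤ (n : ℝ≥0∞) * ENNReal.ofReal c₂ := by gcongr
      _ = ENNReal.ofReal (n * c₂) := by rw [ENNReal.ofReal_mul hn0.le, ENNReal.ofReal_natCast]
      _ ≤ _ := by
        refine ENNReal.ofReal_le_ofReal ?_
        rw [← sq_rpow_half_add hS0.le, hS2, Real.mul_rpow hn0.le hs0.le,
          Real.rpow_add hn0, Real.rpow_one]
        have : c₁ ^ (1 + δ / 2) ≤ s ^ (1 + δ / 2) :=
          Real.rpow_le_rpow hc₁.le hs1.le (by positivity)
        calc n * c₂ ≤ n * (η * ((n : ℝ) ^ (δ / 2) * c₁ ^ (1 + δ / 2))) := by gcongr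
          _ ≤ n * (η * ((n : ℝ) ^ (δ / 2) * s ^ (1 + δ / 2))) := by gcongr
          _ = _ := by ring
  obtain ⟨-, h2⟩ := hclt n (fun _ => (L : Measure (Obs p))) f (√(n * s))
    (fun i d => A.remainder L d i) hnN (fun _ => hfm) hS0 (fun _ => hmean)
    (by rw [hS2]; simp [f, hs]) hmom
  have hstat : ∀ d : Data p n, studentized (fun i => f i (d i) + A.remainder L d i) =
      A.ndcrtStat d d.x := fun d => by
    have : (fun i => f i (d i) + A.remainder L d i) = A.residProd d d.x := by
      ext i; simp [f, Learner.remainder]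
    rw [this]; rfl
  simp_rw [hstat] at h2
  refine h2.trans (add_le_add le_rfl (measure_mono fun d hd hc => hd ?_))
  have e1 : 9 * (min (κ * c₁) (κ ^ 2 * c₁) / 9) * n ≤ κ * (n * s) := by
    calc _ = min (κ * c₁) (κ ^ 2 * c₁) * n := by ring
      _ ≤ κ * s * n := by
        gcongr; exact (min_le_left _ _).trans (by gcongr)
      _ = _ := by ring
  have e2 : 9 * (min (κ * c₁) (κ ^ 2 * c₁) / 9) * n ≤ κ ^ 2 * (n * s) := by
    calc _ = min (κ * c₁) (κ ^ 2 * c₁) * n := by ring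
      _ ≤ κ ^ 2 * s * n := by
        gcongr; exact (min_le_right _ _).trans (by gcongr)
      _ = _ := by ring
  refine ⟨by rw [hS2]; exact hc.1.trans e1, abs_le_of_sq_le_sq ?_ (by positivity)⟩
  rw [mul_pow, hS2]
  exact hc.2.trans e2

/-- Along a sequence of laws that satisfies the conditions, the test has asymptotic level `α` at the
laws of the sequence that are in the null. -/
theorem eventually_lintegral_ndcrtTest_le {α β : ℝ} (hα₀ : 0 < α) (hα₁ : α < 1) (hβ : 0 < β)
    {p : ℕ → ℕ} {A : ∀ n, Learner (p n) n} {L : ∀ n, ProbabilityMeasure (Obs (p n))}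
    (hint : ∀ n, 1 ≤ n → Integrable obsX (L n : Measure (Obs (p n))) ∧
      Integrable obsY (L n : Measure (Obs (p n))))
    (h₁ : NDG1 A L) (h₂ : NDG2 A L) (h₃ : Lyap1 A L) (h₄ : SP1 A L) (h₅ : SP2 L) :
    ∀ᶠ n in atTop, L n ∈ nullLaws (p n) →
      ∫⁻ d, (A n).ndcrtTest d α ∂(sampleLaw n (L n)) ≤ ENNReal.ofReal (α + β) := by
  obtain ⟨t, ρ, ε, hρ, hε, ht₁, ht₂⟩ := exists_gaussian_quantile hα₀ hα₁ (half_pos hβ)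
  obtain ⟨e₀, he₀, hvar⟩ := h₁
  obtain ⟨δ, hδ, hlyap⟩ := h₃
  obtain ⟨hAB, hX', hY'⟩ := h₄
  obtain ⟨c₁, c₂, δ', hc₁, -, hδ', hlow, hupp⟩ := h₅
  obtain ⟨l, N₁, hl, hcrit⟩ := Learner.exists_resample_lt t hρ hε he₀ hδ hα₀ ht₁
  obtain ⟨b, N₂, hb, hstat⟩ := exists_sample_stat_gt_le t (c₂ := c₂) hρ hε hc₁ hδ'
  -- Error budget: one unit from the product rate, eight from the two weighted errors and their
  -- Chebyshev terms, two from the critical value. These eleven units are at most `16 o = β / 2`;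
  -- the other `β / 2` comes from the quantile.
  set o : ℝ≥0∞ := ENNReal.ofReal (β / 32) with ho
  have ho0 : 0 < o := ENNReal.ofReal_pos.2 (by positivity)
  set g : ℝ := √(b * (β / 32))
  have hg : 0 < g := Real.sqrt_pos.mpr (by positivity)
  have hgo : ENNReal.ofReal (g ^ 2 / b) = o := by
    rw [Real.sq_sqrt (by positivity), mul_div_cancel_left₀ _ hb.ne']
  have hvar' : Tendsto (fun n => sampleLaw n (L n)
      {d | ENNReal.ofReal e₀ ≤ (A n).dcrtVar d}ᶜ) atTop (𝓝 0) := by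
    have : ∀ n, sampleLaw n (L n) {d | ENNReal.ofReal e₀ ≤ (A n).dcrtVar d}ᶜ =
        1 - sampleLaw n (L n) {d | ENNReal.ofReal e₀ ≤ (A n).dcrtVar d} := fun n =>
      prob_compl_eq_one_sub (measurableSet_le measurable_const (A n).measurable_dcrtVar)
    simp_rw [this]
    simpa using ENNReal.Tendsto.sub (tendsto_const_nhds (x := (1 : ℝ≥0∞))) hvar (by simp)
  filter_upwards [eventually_ge_atTop 1, eventually_ge_atTop N₁, eventually_ge_atTop N₂,
    (hAB (ENNReal.ofReal √b) (ENNReal.ofReal_pos.2 (Real.sqrt_pos.mpr hb))).eventually_lt_const ho0,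
    (hX' (ENNReal.ofReal g) (ENNReal.ofReal_pos.2 hg)).eventually_lt_const ho0,
    (hY' (ENNReal.ofReal g) (ENNReal.ofReal_pos.2 hg)).eventually_lt_const ho0,
    (hlyap (ENNReal.ofReal l) (ENNReal.ofReal_pos.2 hl)).eventually_lt_const ho0,
    hvar'.eventually_lt_const ho0] with n hn hn₁ hn₂ qAB qX qY qL qV hnull
  obtain ⟨iX, iY⟩ := hint n hn
  have hrem := (A n).measure_remainder_le hn hnull iX iY hb hg
  rw [hgo] at hrem
  have hdata := hstat n (p n) (A n) (L n) hn₂ hnull iX (hlow.trans_le (iInf₂_le n hn))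
    ((le_iSup₂ (f := fun (n : ℕ) (_ : 1 ≤ n) => ∫⁻ o, ENNReal.ofReal
      (|(obsX o - condMean (L n) obsX (obsZ o)) *
        (obsY o - condMean (L n) obsY (obsZ o))| ^ (2 + δ')) ∂(L n : Measure (Obs (p n))))
      n hn).trans_lt hupp)
  set P := sampleLaw n (L n)
  have hfin : P {d | ¬ ∀ i, (A n).fittedVar d i < ∞} = 0 := by
    have h := h₂ n hn
    rw [← ae_iff]
    filter_upwards [h] with d hd i using (hd i).1.2
  have hsub : {d | (A n).ndcrtCrit d α < (A n).ndcrtStat d d.x} ⊆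
      {d | t < (A n).ndcrtStat d d.x} ∪ ({d | ¬ ∀ i, (A n).fittedVar d i < ∞} ∪
        ({d | ENNReal.ofReal e₀ ≤ (A n).dcrtVar d}ᶜ ∪
          {d | ENNReal.ofReal l ≤ (A n).lyapunov d δ})) := by
    intro d hd
    by_contra hc
    simp only [Set.mem_union, Set.mem_compl_iff, Set.mem_ofPred_eq, not_or, not_lt, not_not,
      not_le] at hc
    obtain ⟨k1, k2, k3, k4⟩ := hc
    have hd' : (A n).ndcrtCrit d α < (A n).ndcrtStat d d.x := hd
    have := hcrit n (p n) (A n) d hn₁ k2 k3 k4.le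
    linarith
  have htest : ∫⁻ d, (A n).ndcrtTest d α ∂P ≤
      P {d | (A n).ndcrtCrit d α < (A n).ndcrtStat d d.x} := by
    refine le_trans (le_of_eq (lintegral_congr fun d => ?_)) (lintegral_indicator_one_le _)
    rfl
  calc ∫⁻ d, (A n).ndcrtTest d α ∂P
      ≤ P {d | t < (A n).ndcrtStat d d.x} + (0 + (o + o)) := by
        refine htest.trans ((measure_mono hsub).trans ((measure_union_le _ _).trans ?_))
        refine add_le_add le_rfl ((measure_union_le _ _).trans ?_)
        exact add_le_add hfin.le ((measure_union_le _ _).trans (add_le_add qV.le qL.le))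
    _ ≤ (ENNReal.ofReal (α + β / 2) + (o + 2 * (o + o) + 2 * (o + o))) + (0 + (o + o)) := by
        refine add_le_add (hdata.trans (add_le_add (ENNReal.ofReal_le_ofReal ht₂)
          (hrem.trans ?_))) le_rfl
        gcongr
    _ = ENNReal.ofReal (α + β / 2) + 11 * o := by ring
    _ ≤ ENNReal.ofReal (α + β / 2) + 16 * o := by gcongr; norm_num
    _ = ENNReal.ofReal (α + β) := by
        have : (16 : ℝ≥0∞) = ENNReal.ofReal 16 := by simp
        rw [ho, this, ← ENNReal.ofReal_mul (by norm_num), ← ENNReal.ofReal_add (by positivity)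
          (by positivity)]
        congr 1; ring

end NDCRT

end

/-! ### From sequences to the supremum over laws -/

theorem mainTheorem10 (α : ℝ) (hα₀ : 0 < α) (hα₁ : α < 1)
    (p : ℕ → ℕ) (A : ∀ n, NDCRT.Learner (p n) n)
    (R : ∀ n, Set (ProbabilityMeasure (NDCRT.Obs (p n))))
    (hne : ∀ n, 1 ≤ n → (R n).Nonempty)
    (hint : ∀ n, 1 ≤ n → ∀ L ∈ R n,
      Integrable NDCRT.obsX (L : Measure (NDCRT.Obs (p n))) ∧
        Integrable NDCRT.obsY (L : Measure (NDCRT.Obs (p n))))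
    (hR : ∀ L : (∀ n, ProbabilityMeasure (NDCRT.Obs (p n))), (∀ n, 1 ≤ n → L n ∈ R n) →
      NDCRT.NDG1 A L ∧ NDCRT.NDG2 A L ∧ NDCRT.Lyap1 A L ∧ NDCRT.SP1 A L ∧ NDCRT.SP2 L) :
    limsup (fun n => ⨆ L ∈ NDCRT.nullLaws (p n) ∩ R n,
        ∫⁻ d, (A n).ndcrtTest d α ∂(NDCRT.sampleLaw n L)) atTop ≤ ENNReal.ofReal α := by
  have hbd : ∀ n, ⨆ L ∈ NDCRT.nullLaws (p n) ∩ R n,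
      ∫⁻ d, (A n).ndcrtTest d α ∂(NDCRT.sampleLaw n L) ≤ 1 := fun n => by
    refine iSup₂_le fun L _ => ?_
    calc _ ≤ ∫⁻ _, 1 ∂(NDCRT.sampleLaw n L) := lintegral_mono fun d => by
          unfold NDCRT.Learner.ndcrtTest; split_ifs <;> simp
      _ = 1 := by simp
  refine ENNReal.le_of_forall_pos_le_add fun ε hε _ => ?_
  have hε2 : (0 : ℝ) < ε / 2 := by positivity
  have hε2' : ENNReal.ofReal (ε / 2) ≠ 0 := (ENNReal.ofReal_pos.2 hε2).ne'
  -- A null law within `ε / 2` of the supremum is chosen when there is one. Otherwise any member of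
  -- `R n` keeps the sequence admissible, which is where nonemptiness matters; at `n = 0` the choice
  -- is arbitrary.
  have hsel : ∀ n, ∃ L : ProbabilityMeasure (NDCRT.Obs (p n)), (1 ≤ n → L ∈ R n) ∧
      (1 ≤ n → (NDCRT.nullLaws (p n) ∩ R n).Nonempty → L ∈ NDCRT.nullLaws (p n) ∧
        ⨆ L ∈ NDCRT.nullLaws (p n) ∩ R n,
          ∫⁻ d, (A n).ndcrtTest d α ∂(NDCRT.sampleLaw n L) ≤
        ∫⁻ d, (A n).ndcrtTest d α ∂(NDCRT.sampleLaw n L) + ENNReal.ofReal (ε / 2)) := by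
    intro n
    by_cases hn : 1 ≤ n
    · by_cases hN : (NDCRT.nullLaws (p n) ∩ R n).Nonempty
      -- Without a near-maximizer the supremum would be at most itself minus `ε / 2`, impossible for
      -- a finite positive value. Positivity is needed because subtraction is truncated.
      · by_contra! hcon
        have hlt : ∀ L ∈ NDCRT.nullLaws (p n) ∩ R n,
            ∫⁻ d, (A n).ndcrtTest d α ∂(NDCRT.sampleLaw n L) + ENNReal.ofReal (ε / 2) ≤
            ⨆ L ∈ NDCRT.nullLaws (p n) ∩ R n,
              ∫⁻ d, (A n).ndcrtTest d α ∂(NDCRT.sampleLaw n L) := fun L hL =>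
          ((hcon L fun _ => hL.2).2.2 hL.1).le
        have hle : (⨆ L ∈ NDCRT.nullLaws (p n) ∩ R n,
              ∫⁻ d, (A n).ndcrtTest d α ∂(NDCRT.sampleLaw n L)) ≤
            (⨆ L ∈ NDCRT.nullLaws (p n) ∩ R n,
              ∫⁻ d, (A n).ndcrtTest d α ∂(NDCRT.sampleLaw n L)) - ENNReal.ofReal (ε / 2) :=
          iSup₂_le fun L hL => ENNReal.le_sub_of_add_le_right ENNReal.ofReal_ne_top (hlt L hL)
        obtain ⟨L, hL⟩ := hN
        have hpos : (⨆ L ∈ NDCRT.nullLaws (p n) ∩ R n,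
              ∫⁻ d, (A n).ndcrtTest d α ∂(NDCRT.sampleLaw n L)) ≠ 0 :=
          ((ENNReal.ofReal_pos.2 hε2).trans_le (le_add_self.trans (hlt L hL))).ne'
        have hfin := (hbd n).trans_lt ENNReal.one_lt_top
        exact absurd hle (not_le.mpr (ENNReal.sub_lt_self hfin.ne hpos hε2'))
      · obtain ⟨L, hL⟩ := hne n hn
        exact ⟨L, fun _ => hL, fun _ h => absurd h hN⟩
    · exact ⟨⟨Measure.dirac 0, inferInstance⟩, fun h => absurd h hn, fun h => absurd h hn⟩
  choose L hLR hLsup using hsel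
  obtain ⟨h₁, h₂, h₃, h₄, h₅⟩ := hR L hLR
  have hev := NDCRT.eventually_lintegral_ndcrtTest_le hα₀ hα₁ hε2
    (fun n hn => hint n hn (L n) (hLR n hn)) h₁ h₂ h₃ h₄ h₅
  refine limsup_le_of_le (by isBoundedDefault) ?_
  filter_upwards [hev, eventually_ge_atTop 1] with n hn hn1
  by_cases hN : (NDCRT.nullLaws (p n) ∩ R n).Nonempty
  · obtain ⟨k1, k2⟩ := hLsup n hn1 hN
    refine k2.trans ((add_le_add (hn k1) le_rfl).trans (le_of_eq ?_))
    rw [← ENNReal.ofReal_add (by positivity) hε2.le, add_assoc, add_halves,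
      ENNReal.ofReal_add hα₀.le (by positivity), ENNReal.ofReal_coe_nnreal]
  · rw [Set.not_nonempty_iff_eq_empty.1 hN]
    simp
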